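/- Logarithms are natural, and tempered distributions are real ($\mathcal S'(\mathbb R)$ with the $\sigma$-algebra generated by the evaluations). Let $X$ and $Y$ be independent random tempered distributions on a probability space such that for every real Schwartz function $\varphi$ $$\mathbb E\,e^{\mathrm i\langle X,\varphi\rangle}=\exp\int_{\mathbb R} f_X(\varphi(t))\,dt,\qquad \mathbb E\,e^{\mathrm i\langle Y,\varphi\rangle}=\exp\int_{\mathbb R} f_Y(\varphi(t))\,dt .$$ Here $X$ is a stable white noise with parameters $\alpha\in(0,2]$, $\beta\in[-1,1]$, $\sigma>0$, $\mu\in\mathbb R$, that is, $$f_X(\omega)=\mathrm i\omega\mu-\sigma^\alpha|\omega|^\alpha\bigl(1-\mathrm i\beta\,\mathrm{sgn}(\omega)\,\Phi(\omega)\bigr),\qquad \Phi(\omega)=\tan\tfrac{\pi\alpha}{2}\ (\alpha\ne1),\quad \Phi(\omega)=-\tfrac2\pi\log|\omega|\ (\alpha=1),$$ and $Y$ is an impulsive Poisson white noise with rate $\lambda>0$ and amplitude random variable $A$ with law $\nu$, that is, $$f_Y(\omega)=\lambda\int_{\mathbb R\setminus\{0\}}(e^{\mathrm i a\omega}-1)\,d\nu(a).$$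 Assume that $\mathbb E|A|^\theta<\infty$ for some $\theta>0$, and put $Z=X+Y$. For a bounded function $g$ of bounded support, $\langle X,g\rangle$ denotes the limit in probability of $\langle X,\psi_k\rangle$ along every sequence of Schwartz functions $\psi_k$ that are uniformly bounded, vanish outside a common bounded interval, and converge to $g$ in $L^1(\mathbb R)$; similarly for $Z$. Let $X_0=\langle X,\mathbf 1_{[0,1)}\rangle$ and, for $n\ge1$ and $i\in\mathbb Z$, let $Z^{(n)}_i=\langle Z,\mathbf 1_{[(i-1)/n,\,i/n)}\rangle$. For real $m>0$ let $[x]_m=\frac1m\lfloor\frac12+mx\rfloor$. With $H$ the Shannon entropy of a discrete random vector, let $$\mathcal H_{m,n}(Z)=\lim_{T\to\infty}\frac{1}{2T}\,H\bigl([Z^{(n)}_i]_m:\ -nT+1\le i\le nT\bigr).$$ Then the random variables $X_0$ and $Z_i^{(n)}$ exist; $X_0$ has a density $p$ with $p\log p$ integrable, so that its differential entropy $h(X_0)=\int p\log\frac1p$ is well defined and finite; for all $n\ge1$ and real $m>0$ the limit $\mathcal H_{m,n}(Z)$ exists, is finite and equals $n\,H([Z^{(n)}_1]_m)$; and for every $m(\cdot):\mathbb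 N\to\mathbb N$ with $\lim_{n\to\infty}m(n)/\sqrt[\alpha]{n}=\infty$, $$\lim_{n\to\infty}\ \sup_{m\ge m(n)}\left|\frac{\mathcal H_{m,n}(Z)}{n}-\log\frac{m}{\sqrt[\alpha]{n}}-h(X_0)\right|=0,$$ where the supremum is over all real $m\ge m(n)$. -/

import Mathlib

open MeasureTheory ProbabilityTheory Filter Topology
open scoped SchwartzMap ENNReal

/-- Real tempered distributions: continuous linear functionals on the real Schwartz space. -/
abbrev RealTemperedDistribution : Type := 𝓢(ℝ, ℝ) →L[ℝ] ℝ

/-- The cylindrical `σ`-algebra, generated by the evaluations `x ↦ ⟨x, φ⟩`. -/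
noncomputable instance cylindricalMeasurableSpace : MeasurableSpace RealTemperedDistribution :=
  ⨆ φ : 𝓢(ℝ, ℝ), MeasurableSpace.comap (fun x : RealTemperedDistribution => x φ) inferInstance

noncomputable section

/-! ### White noises -/

/-- The generalized process `X` (a random tempered distribution) has the characteristic functional
of the white noise with exponent `f`, that is, `E[exp(i⟨X, φ⟩)] = exp(∫ f(φ(t)) dt)` for all
Schwartz functions `φ`. -/
def HasWhiteNoiseExponent {Ω : Type*} [MeasurableSpace Ω] (P : Measure Ω)
    (X : Ω → RealTemperedDistribution) (f : ℝ → ℂ) : Prop :=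
  ∀ φ : 𝓢(ℝ, ℝ),
    ∫ ω, Complex.exp (Complex.I * ((X ω φ : ℝ) : ℂ)) ∂P = Complex.exp (∫ t : ℝ, f (φ t))

/-- The function `Φ` in the exponent of a stable law. -/
def stablePhi (α w : ℝ) : ℝ :=
  if α = 1 then -(2 / Real.pi) * Real.log |w| else Real.tan (Real.pi * α / 2)

/-- `f(w) = i w μ - σ^α |w|^α (1 - i β sgn(w) Φ(w))`. -/
def stableExponent (α β σ μ : ℝ) (w : ℝ) : ℂ :=
  Complex.I * (w : ℂ) * (μ : ℂ)
    - ((σ ^ α * |w| ^ α : ℝ) : ℂ) *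
      (1 - Complex.I * (β : ℂ) * ((Real.sign w * stablePhi α w : ℝ) : ℂ))

/-- A stable white noise with parameters `(α, β, σ, μ)`. -/
structure IsStableWhiteNoise {Ω : Type*} [MeasurableSpace Ω] (P : Measure Ω)
    (X : Ω → RealTemperedDistribution) (α β σ μ : ℝ) : Prop where
  measurable : Measurable X
  alpha_pos : 0 < α
  alpha_le : α ≤ 2
  beta_mem : β ∈ Set.Icc (-1 : ℝ) 1
  sigma_pos : 0 < σ
  exponent : HasWhiteNoiseExponent P X (stableExponent α β σ μ)

/-- `f(w) = r ∫_{a ≠ 0} (exp(i a w) - 1) dν(a)`, with rate `r` and amplitude law `ν`. -/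
def poissonExponent (r : ℝ) (ν : Measure ℝ) (w : ℝ) : ℂ :=
  (r : ℂ) * ∫ a in ({0}ᶜ : Set ℝ), (Complex.exp (Complex.I * (a : ℂ) * (w : ℂ)) - 1) ∂ν

/-- An impulsive Poisson white noise with rate `r` and amplitude law `ν`. -/
structure IsImpulsivePoissonWhiteNoise {Ω : Type*} [MeasurableSpace Ω] (P : Measure Ω)
    (Y : Ω → RealTemperedDistribution) (r : ℝ) (ν : Measure ℝ) : Prop where
  measurable : Measurable Y
  rate_pos : 0 < r
  amplitude : IsProbabilityMeasure ν
  exponent : HasWhiteNoiseExponent P Y (poissonExponent r ν)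

/-! ### Time quantization -/

/-- The random variable `R` is `⟨X, g⟩` for a function `g` that need not be a Schwartz function:
`⟨X, ψ k⟩ → R` in probability for every sequence of Schwartz functions `ψ k` that is uniformly
bounded, vanishes outside a common bounded interval, and converges to `g` in `L¹`. -/
def IsPairing {Ω : Type*} [MeasurableSpace Ω] (P : Measure Ω)
    (X : Ω → RealTemperedDistribution) (g : ℝ → ℝ) (R : Ω → ℝ) : Prop :=
  Measurable R ∧
    ∀ ψ : ℕ → 𝓢(ℝ, ℝ),
      (∃ C : ℝ, ∀ k t, |ψ k t| ≤ C) →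
      (∃ K : ℝ, ∀ k t, K < |t| → ψ k t = 0) →
      Tendsto (fun k => ∫⁻ t : ℝ, ‖ψ k t - g t‖ₑ) atTop (𝓝 0) →
      TendstoInMeasure P (fun k ω => X ω (ψ k)) atTop R

/-- The indicator function of `[0, 1)`. -/
def pulse (t : ℝ) : ℝ := Set.indicator (Set.Ico (0 : ℝ) 1) (fun _ => 1) t

/-- `R i = ⟨X, φ_{i,n}⟩` for all integers `i`, where `φ_{i,n}(t) = φ(n t - i + 1)` is the indicator
of `[(i - 1) / n, i / n)`. -/
def IsTimeQuantization {Ω : Type*} [MeasurableSpace Ω] (P : Measure Ω)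
    (X : Ω → RealTemperedDistribution) (n : ℕ) (R : ℤ → Ω → ℝ) : Prop :=
  ∀ i : ℤ, IsPairing P X (fun t => pulse (n * t - i + 1)) (R i)

/-! ### Amplitude quantization and entropies -/

/-- Quantization with step size `1 / m`. -/
def quantize (m x : ℝ) : ℝ := 1 / m * (⌊1 / 2 + m * x⌋ : ℝ)

/-- The entropy (natural logarithm) `∑ p(v) log(1 / p(v))` of a discrete random element `V`,
as a value in `[0, ∞]`. -/
def discreteEntropy {Ω : Type*} [MeasurableSpace Ω] (P : Measure Ω) {E : Type*}
    (V : Ω → E) : ℝ≥0∞ :=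
  ∑' v : E, ENNReal.ofReal (Real.negMulLog (P.real (V ⁻¹' {v})))

/-- The vector of the quantized samples number `n (i - 1) + 1, …, n i`. -/
def quantBlock {Ω : Type*} (m : ℝ) (n : ℕ) (R : ℤ → Ω → ℝ) (i : ℤ) (ω : Ω) : Fin n → ℝ :=
  fun j => quantize m (R (n * (i - 1) + 1 + (j : ℕ)) ω)

/-- The blocks number `-T + 1, …, T`. -/
def quantWindow {Ω : Type*} (m : ℝ) (n : ℕ) (R : ℤ → Ω → ℝ) (T : ℕ) (ω : Ω) :
    Fin (2 * T) → Fin n → ℝ :=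
  fun a => quantBlock m n R (-(T : ℤ) + 1 + (a : ℕ)) ω

/-- The entropy of the doubly quantized process on `[-T, T)`, per unit of time. -/
def windowEntropyRate {Ω : Type*} [MeasurableSpace Ω] (P : Measure Ω) (m : ℝ) (n : ℕ)
    (R : ℤ → Ω → ℝ) (T : ℕ) : ℝ≥0∞ :=
  discreteEntropy P (quantWindow m n R T) / (2 * T)

/-- The quantization entropy `H_{m,n}` of a process with time quantization `R` of step `1 / n`:
the limit of the entropy rate of the window `[-T, T)` as `T → ∞`. -/
def quantizationEntropy {Ω : Type*} [MeasurableSpace Ω] (P : Measure Ω) (m : ℝ) (n : ℕ)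
    (R : ℤ → Ω → ℝ) : ℝ≥0∞ :=
  limUnder atTop (windowEntropyRate P m n R)

/-- The integrand `p(x) log(1 / p(x))` of the differential entropy of `W`, with `p` the density
of `W`. -/
def entropyDensity {Ω : Type*} [MeasurableSpace Ω] (P : Measure Ω) (W : Ω → ℝ) (x : ℝ) : ℝ :=
  Real.negMulLog (pdf W P volume x).toReal

/-- `W` has a density, and its differential entropy is well defined and finite. -/
def HasDifferentialEntropy {Ω : Type*} [MeasurableSpace Ω] (P : Measure Ω) (W : Ω → ℝ) : Prop :=
  HasPDF W P volume ∧ Integrable (entropyDensity P W) volume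

/-- The differential entropy `h(W) = ∫ p(x) log(1 / p(x)) dx`. -/
def differentialEntropy {Ω : Type*} [MeasurableSpace Ω] (P : Measure Ω) (W : Ω → ℝ) : ℝ :=
  ∫ x, entropyDensity P W x

end

/-! ### Convergence of entropy integrals -/

/-! Put c = n^(1/α). Intervals of length 1/n with distinct indices are disjoint, and an exponent
vanishing at 0 is additive over disjoint supports, so the samples of Z are independent, each with
characteristic function exp((f_X + f_Y)/n) (`integral_exp_sum_isPairing`). Entropy is additive over
independent samples (`discreteEntropy_quantWindow`), so everything reduces to the entropy of one
quantized sample.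

Stability says that f_X(c t)/n is f_X(t) plus a drift term linear in t
(`exists_stableExponent_scaling`), while the Poisson part f_Y(c t)/n is at most 2r/n because f_Y is
bounded. Hence c Z₁ - d, for a suitable shift d, has a characteristic function that stays below the
integrable envelope exp(-σ^α |t|^α) and converges in L¹ to that of X₀. By Fourier inversion its
density converges uniformly to the density p of X₀. Quantizing Z₁ with step 1/m amounts to
quantizing c Z₁ - d with step c/m and a moved offset (`discreteEntropy_quantize_affine`), and the
entropy of the result is log(m/c) plus the differential entropy of the density averaged over bins
(`hasSum_negMulLog_bins`). As m/c tends to infinity, the averaged densities tend to p.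

The limit must still be taken inside the entropy integral, where the uniform bound on the densities
leaves the tails uncontrolled. A fractional moment bound uniform in n supplies that control
(`tendsto_integral_negMulLog`). It follows from |1 - φ(t)| ≤ C |t|^s near 0
(`exists_lintegral_rpow_le_of_charFun`). The moment of A gives such a bound for f_Y, and s ≤ α keeps
C independent of n (`norm_one_sub_exp_scaled_le`). Uniformity in m comes from taking one limit along
a filter on pairs (n, m). -/

theorem abs_negMulLog_le {a B c : ℝ} (ha : 0 ≤ a) (haB : a ≤ B) (hB : 1 ≤ B) (hc : 0 ≤ c) :
    |Real.negMulLog a| ≤ c * a + (1 + B ^ 2 * Real.log B) * Real.exp (-c) := by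
  have hlB : 0 ≤ Real.log B := Real.log_nonneg hB
  have hBl : 0 ≤ B ^ 2 * Real.log B := by positivity
  have he := Real.exp_pos (-c)
  rcases le_or_gt a 1 with h | h
  · rw [abs_of_nonneg (Real.negMulLog_nonneg ha h)]
    -- Tilting by exp c splits off the term c * a exactly, and the remaining `negMulLog` is at most
    -- 1.
    have h1 : a = a * Real.exp c * Real.exp (-c) := by
      rw [mul_assoc, ← Real.exp_add]; simp
    have h2 : Real.negMulLog a
        = Real.exp (-c) * Real.negMulLog (a * Real.exp c) + a * c := by
      conv_lhs => rw [h1, Real.negMulLog_mul]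
      rw [Real.negMulLog, Real.negMulLog, Real.log_exp]
      linear_combination (-c) * h1
    have h3 := Real.negMulLog_le_one_sub_self (x := a * Real.exp c) (by positivity)
    have h4 : Real.negMulLog (a * Real.exp c) ≤ 1 :=
      h3.trans (by have : 0 ≤ a * Real.exp c := by positivity
                   linarith)
    nlinarith [mul_le_mul_of_nonneg_left h4 he.le, mul_nonneg hBl he.le]
  · have hl : Real.log a ≤ Real.log B := Real.log_le_log (by linarith) haB
    have hl0 : 0 ≤ Real.log a := Real.log_nonneg h.le
    rw [Real.negMulLog, abs_mul, abs_neg, abs_of_nonneg ha, abs_of_nonneg hl0]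
    -- Either c dominates log a, or exp (-c) is at least 1 / B and the constant B² log B absorbs B
    -- log B.
    rcases le_or_gt (Real.log B) c with h1 | h1
    · have : a * Real.log a ≤ c * a := by nlinarith
      nlinarith [mul_nonneg hBl he.le]
    · have h2 : B⁻¹ ≤ Real.exp (-c) := by
        rw [← Real.exp_log (show 0 < B⁻¹ by positivity), Real.log_inv]
        exact Real.exp_le_exp.2 (by linarith)
      have h3 : a * Real.log a ≤ B * Real.log B := by gcongr
      have h4 : B * Real.log B = B ^ 2 * Real.log B * B⁻¹ := by field_simp
      have h5 := mul_le_mul_of_nonneg_left h2 hBl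
      nlinarith [mul_nonneg hc ha]

theorem integrable_exp_neg_mul_abs_rpow {s b : ℝ} (hs : 0 < s) (hb : 0 < b) :
    Integrable (fun x : ℝ => Real.exp (-b * |x| ^ s)) := by
  have h := integrableOn_rpow_mul_exp_neg_mul_rpow (s := 0) (by norm_num) hs hb
  simp only [Real.rpow_zero, one_mul] at h
  have h1 : IntegrableOn (fun x : ℝ => Real.exp (-b * |x| ^ s)) (Set.Ioi 0) :=
    h.congr_fun (fun x hx => by simp only [abs_of_pos (Set.mem_Ioi.1 hx)]) measurableSet_Ioi
  have h2 : IntegrableOn (fun x : ℝ => Real.exp (-b * |x| ^ s)) (Set.Iic 0) := by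
    rw [integrableOn_Iic_iff_integrableOn_Iio]
    have h3 := ((Measure.measurePreserving_neg (volume : Measure ℝ)).integrableOn_comp_preimage
      (Homeomorph.neg ℝ).measurableEmbedding).2 h1
    rw [Set.neg_preimage, Set.neg_Ioi, neg_zero] at h3
    refine h3.congr_fun (fun x _ => ?_) measurableSet_Iio
    simp only [Function.comp_apply, abs_neg]
  rw [← integrableOn_univ, ← Set.Iic_union_Ioi (a := (0 : ℝ))]
  exact h2.union h1

/-- This is `abs_negMulLog_le` with c = |x|^s: the first term is controlled by the moment, the
second by a stretched exponential. -/
theorem integrable_negMulLog_of_moment {a : ℝ → ℝ} {B s : ℝ} (hs : 0 < s) (hm : Measurable a)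
    (h0 : ∀ x, 0 ≤ a x) (hB : ∀ x, a x ≤ B) (hw : ∫⁻ x, ENNReal.ofReal (a x * |x| ^ s) ≠ ∞) :
    Integrable (fun x => Real.negMulLog (a x)) := by
  have hwi : Integrable (fun x => a x * |x| ^ s) := by
    refine ⟨by fun_prop, ?_⟩
    rw [hasFiniteIntegral_iff_ofReal (ae_of_all _ fun x => mul_nonneg (h0 x) (by positivity))]
    exact lt_top_iff_ne_top.2 hw
  have hB1 : ∀ x, a x ≤ max B 1 := fun x => (hB x).trans (le_max_left _ _)
  refine Integrable.mono' (hwi.add ((integrable_exp_neg_mul_abs_rpow hs one_pos).const_mul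
    (1 + (max B 1) ^ 2 * Real.log (max B 1)))) ?_ (ae_of_all _ fun x => ?_)
  · exact (Real.continuous_negMulLog.measurable.comp hm).aestronglyMeasurable
  · have := abs_negMulLog_le (h0 x) (hB1 x) (le_max_right _ _) (show 0 ≤ |x| ^ s by positivity)
    rw [Real.norm_eq_abs]
    simp only [Pi.add_apply]
    convert this using 2
    · ring
    · ring_nf

/-- With c = ε |x|^s in `abs_negMulLog_le`, the part of the difference exceeding ε times the two
weighted densities is dominated by a fixed integrable function, so dominated convergence applies to
it. What was subtracted has integral at most 2εK, uniformly along the filter. -/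
theorem tendsto_integral_negMulLog {ι : Type*} {l : Filter ι} [l.IsCountablyGenerated]
    {a : ι → ℝ → ℝ} {p : ℝ → ℝ} {B s : ℝ} {K : ℝ≥0∞} (hs : 0 < s) (hK : K ≠ ∞)
    (ham : ∀ i, Measurable (a i)) (hpm : Measurable p)
    (ha0 : ∀ᶠ i in l, ∀ x, 0 ≤ a i x) (haB : ∀ᶠ i in l, ∀ x, a i x ≤ B)
    (hp0 : ∀ x, 0 ≤ p x) (hpB : ∀ x, p x ≤ B)
    (haw : ∀ᶠ i in l, ∫⁻ x, ENNReal.ofReal (a i x * |x| ^ s) ≤ K)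
    (hpw : ∫⁻ x, ENNReal.ofReal (p x * |x| ^ s) ≤ K)
    (hlim : ∀ x, Tendsto (fun i => a i x) l (𝓝 (p x))) :
    Tendsto (fun i => ∫ x, Real.negMulLog (a i x)) l (𝓝 (∫ x, Real.negMulLog (p x))) := by
  have hpi := integrable_negMulLog_of_moment hs hpm hp0 hpB (ne_top_of_le_ne_top hK hpw)
  have hηc := Real.continuous_negMulLog
  have hηm := hηc.measurable
  set C : ℝ := 1 + (max B 1) ^ 2 * Real.log (max B 1) with hC
  have hC0 : 0 ≤ C := by
    have := Real.log_nonneg (le_max_right B 1)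
    positivity
  -- the truncated differences vanish by dominated convergence
  have key : ∀ ε : ℝ, 0 < ε → Tendsto (fun i => ∫⁻ x, ENNReal.ofReal
      (|Real.negMulLog (a i x) - Real.negMulLog (p x)| - ε * (a i x * |x| ^ s + p x * |x| ^ s)))
      l (𝓝 0) := by
    intro ε hε
    have := tendsto_lintegral_filter_of_dominated_convergence (μ := volume) (l := l)
      (F := fun i x => ENNReal.ofReal
        (|Real.negMulLog (a i x) - Real.negMulLog (p x)| - ε * (a i x * |x| ^ s + p x * |x| ^ s)))
      (f := fun _ => 0) (fun x => ENNReal.ofReal (2 * C * Real.exp (-ε * |x| ^ s)))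
      (Eventually.of_forall fun i => by
        have h1 := ham i
        have h2 := hηm.comp (ham i)
        have h3 := hηm.comp hpm
        simp only [Function.comp_def] at h2 h3
        fun_prop) ?_ ?_ ?_
    · simpa using this
    · filter_upwards [haB, ha0] with i hi hi0
      refine ae_of_all _ fun x => ENNReal.ofReal_le_ofReal ?_
      have h1 := abs_negMulLog_le (hi0 x) ((hi x).trans (le_max_left B 1)) (le_max_right B 1)
        (show 0 ≤ ε * |x| ^ s by positivity)
      have h2 := abs_negMulLog_le (hp0 x) ((hpB x).trans (le_max_left B 1)) (le_max_right B 1)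
        (show 0 ≤ ε * |x| ^ s by positivity)
      have h3 := abs_sub (Real.negMulLog (a i x)) (Real.negMulLog (p x))
      rw [← hC] at h1 h2
      rw [neg_mul]
      nlinarith
    · have := ((integrable_exp_neg_mul_abs_rpow hs hε).const_mul (2 * C)).lintegral_lt_top
      exact this.ne
    · refine ae_of_all _ fun x => ?_
      have h1 : Tendsto (fun i => |Real.negMulLog (a i x) - Real.negMulLog (p x)|
          - ε * (a i x * |x| ^ s + p x * |x| ^ s)) l
          (𝓝 (|Real.negMulLog (p x) - Real.negMulLog (p x)|
          - ε * (p x * |x| ^ s + p x * |x| ^ s))) :=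
        ((((hηc.tendsto _).comp (hlim x)).sub_const _).abs).sub
          ((((hlim x).mul_const _).add_const _).const_mul _)
      have h2 := (ENNReal.continuous_ofReal.tendsto _).comp h1
      have h3 : ENNReal.ofReal (|Real.negMulLog (p x) - Real.negMulLog (p x)|
          - ε * (p x * |x| ^ s + p x * |x| ^ s)) = 0 := by
        apply ENNReal.ofReal_of_nonpos
        have : 0 ≤ ε * (p x * |x| ^ s + p x * |x| ^ s) := by
          have := hp0 x
          positivity
        simp only [sub_self, abs_zero]
        linarith
      rw [h3] at h2
      exact h2
  have hmain : Tendsto (fun i => ∫⁻ x, ENNReal.ofReal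
      |Real.negMulLog (a i x) - Real.negMulLog (p x)|) l (𝓝 0) := by
    rw [ENNReal.tendsto_nhds_zero]
    intro δ hδ
    rcases eq_or_ne δ ∞ with rfl | hδt
    · simp
    obtain ⟨ε, hε, hεK⟩ : ∃ ε : ℝ, 0 < ε ∧ ENNReal.ofReal ε * (K + K) ≤ δ / 2 := by
      refine ⟨(δ / 2).toReal / ((K + K).toReal + 1), ?_, ?_⟩
      · have : 0 < (δ / 2).toReal := ENNReal.toReal_pos (by simpa using hδ.ne')
          (ENNReal.div_ne_top hδt (by norm_num))
        positivity
      · rw [← ENNReal.ofReal_toReal (a := K + K) (by simp [hK]),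
          ← ENNReal.ofReal_mul (by positivity)]
        refine ENNReal.ofReal_le_of_le_toReal ?_
        rw [ENNReal.toReal_ofReal (by positivity), div_mul_eq_mul_div]
        apply div_le_of_le_mul₀ (by positivity) (by positivity)
        gcongr
        linarith
    filter_upwards [(ENNReal.tendsto_nhds_zero.1 (key ε hε)) (δ / 2) (by simpa using hδ.ne'), haw, ha0]
      with i hi hiw hi0
    calc ∫⁻ x, ENNReal.ofReal |Real.negMulLog (a i x) - Real.negMulLog (p x)|
        ≤ ∫⁻ x, (ENNReal.ofReal (|Real.negMulLog (a i x) - Real.negMulLog (p x)|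
            - ε * (a i x * |x| ^ s + p x * |x| ^ s)) + ENNReal.ofReal ε *
            (ENNReal.ofReal (a i x * |x| ^ s) + ENNReal.ofReal (p x * |x| ^ s))) := by
          refine lintegral_mono fun x => ?_
          have := hi0 x
          have := hp0 x
          rw [← ENNReal.ofReal_add (by positivity) (by positivity),
            ← ENNReal.ofReal_mul hε.le]
          refine le_trans (ENNReal.ofReal_le_ofReal ?_) ENNReal.ofReal_add_le
          linarith
      _ = _ := by
          rw [lintegral_add_right _ (by have := ham i; fun_prop), lintegral_const_mul _
            (by have := ham i; fun_prop), lintegral_add_right _ (by fun_prop)]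
      _ ≤ δ / 2 + ENNReal.ofReal ε * (K + K) := by gcongr
      _ ≤ δ / 2 + δ / 2 := by gcongr
      _ = δ := ENNReal.add_halves δ
  refine tendsto_integral_of_L1 _ hpi.aestronglyMeasurable ?_ ?_
  · filter_upwards [haB, haw, ha0] with i hi hw hi0
    exact integrable_negMulLog_of_moment hs (ham i) hi0 hi (ne_top_of_le_ne_top hK hw)
  · simpa only [Real.enorm_eq_ofReal_abs] using hmain

/-! ### Densities that are constant on the bins of a uniform quantizer -/

/-- The bin of `x` for the quantizer `x ↦ ⌊u + m x⌋`. -/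
def quantBin (u m x : ℝ) : Set ℝ := {y | ⌊u + m * y⌋ = ⌊u + m * x⌋}

/-- The density that spreads the mass of each bin uniformly over that bin. -/
noncomputable def binDensity (μ : Measure ℝ) (u m x : ℝ) : ℝ := m * μ.real (quantBin u m x)

theorem floor_preimage_eq_Ico {m : ℝ} (hm : 0 < m) (u : ℝ) (k : ℤ) :
    {y : ℝ | ⌊u + m * y⌋ = k} = Set.Ico ((k - u) / m) ((k + 1 - u) / m) := by
  ext y
  rw [Set.mem_ofPred_eq, Int.floor_eq_iff, Set.mem_Ico, div_le_iff₀ hm, lt_div_iff₀ hm]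
  constructor <;> rintro ⟨h1, h2⟩ <;> constructor <;> linarith

theorem volume_floor_preimage {m : ℝ} (hm : 0 < m) (u : ℝ) (k : ℤ) :
    volume {y : ℝ | ⌊u + m * y⌋ = k} = ENNReal.ofReal (1 / m) := by
  rw [floor_preimage_eq_Ico hm, Real.volume_Ico]
  congr 1
  field_simp
  ring

theorem measurableSet_floor_preimage (u m : ℝ) (k : ℤ) :
    MeasurableSet {y : ℝ | ⌊u + m * y⌋ = k} :=
  (Int.measurable_floor.comp (by fun_prop : Measurable fun y : ℝ => u + m * y))
    (measurableSet_singleton k)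

theorem abs_sub_le_of_mem_quantBin {u m x y : ℝ} (hm : 0 < m) (h : y ∈ quantBin u m x) :
    |y - x| ≤ 1 / m := by
  have h1 := Int.abs_sub_lt_one_of_floor_eq_floor h
  rw [show u + m * y - (u + m * x) = m * (y - x) by ring, abs_mul, abs_of_pos hm] at h1
  rw [le_div_iff₀ hm]
  linarith

theorem binDensity_nonneg (μ : Measure ℝ) {m : ℝ} (hm : 0 < m) (u x : ℝ) :
    0 ≤ binDensity μ u m x :=
  mul_nonneg hm.le measureReal_nonneg

theorem binDensity_le (μ : Measure ℝ) [IsProbabilityMeasure μ] {m : ℝ} (hm : 0 < m) (u x : ℝ) :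
    binDensity μ u m x ≤ m :=
  mul_le_of_le_one_right hm.le measureReal_le_one

theorem measurable_binDensity (μ : Measure ℝ) (u m : ℝ) : Measurable (binDensity μ u m) := by
  have h : Measurable fun x : ℝ => ⌊u + m * x⌋ :=
    Int.measurable_floor.comp (by fun_prop : Measurable fun y : ℝ => u + m * y)
  exact (measurable_from_top (f := fun k : ℤ => m * μ.real {y | ⌊u + m * y⌋ = k})).comp h

theorem binDensity_le_of_density {μ : Measure ℝ} {q : ℝ → ℝ}
    (hμ : μ = volume.withDensity fun x => ENNReal.ofReal (q x)) {u m x U : ℝ} (hm : 0 < m)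
    (hU0 : 0 ≤ U) (hU : ∀ y ∈ quantBin u m x, q y ≤ U) : binDensity μ u m x ≤ U := by
  have hms : MeasurableSet (quantBin u m x) := measurableSet_floor_preimage u m _
  have hv : volume (quantBin u m x) = ENNReal.ofReal (1 / m) := volume_floor_preimage hm u _
  have h : μ (quantBin u m x) ≤ ENNReal.ofReal (U * (1 / m)) := by
    rw [hμ, withDensity_apply _ hms, ENNReal.ofReal_mul hU0, ← hv, ← setLIntegral_const]
    exact setLIntegral_mono measurable_const fun y hy => ENNReal.ofReal_le_ofReal (hU y hy)
  have h2 := ENNReal.toReal_le_of_le_ofReal (by positivity) h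
  rw [binDensity, Measure.real]
  calc m * (μ (quantBin u m x)).toReal ≤ m * (U * (1 / m)) := by gcongr
    _ = U := by field_simp

theorem le_binDensity_of_density {μ : Measure ℝ} [IsFiniteMeasure μ] {q : ℝ → ℝ}
    (hμ : μ = volume.withDensity fun x => ENNReal.ofReal (q x)) {u m x b : ℝ} (hm : 0 < m)
    (hq : Measurable q) (hb : ∀ y ∈ quantBin u m x, b ≤ q y) : b ≤ binDensity μ u m x := by
  rcases le_or_gt b 0 with hb0 | hb0
  · exact hb0.trans (binDensity_nonneg μ hm u x)
  have hms : MeasurableSet (quantBin u m x) := measurableSet_floor_preimage u m _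
  have hv : volume (quantBin u m x) = ENNReal.ofReal (1 / m) := volume_floor_preimage hm u _
  have h : ENNReal.ofReal (b * (1 / m)) ≤ μ (quantBin u m x) := by
    rw [hμ, withDensity_apply _ hms, ENNReal.ofReal_mul hb0.le, ← hv, ← setLIntegral_const]
    exact setLIntegral_mono (by fun_prop) fun y hy => ENNReal.ofReal_le_ofReal (hb y hy)
  have h2 := (ENNReal.ofReal_le_iff_le_toReal (measure_ne_top _ _)).1 h
  rw [binDensity, Measure.real]
  calc b = m * (b * (1 / m)) := by field_simp
    _ ≤ _ := by gcongr

/-- Tonelli turns the left side into an average over the bin of a `μ`-distributed point y. A point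
of that bin is within 1/m of y, and the power s ≤ 1 is subadditive. -/
theorem lintegral_binDensity_mul_rpow_le (μ : Measure ℝ) [IsProbabilityMeasure μ] {u m s : ℝ}
    (hm : 0 < m) (hs : 0 < s) (hs1 : s ≤ 1) :
    ∫⁻ x, ENNReal.ofReal (binDensity μ u m x * |x| ^ s)
      ≤ ∫⁻ y, ENNReal.ofReal (|y| ^ s) ∂μ + ENNReal.ofReal ((1 / m) ^ s) := by
  have hfl : Measurable fun x : ℝ => ⌊u + m * x⌋ :=
    Int.measurable_floor.comp (by fun_prop : Measurable fun y : ℝ => u + m * y)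
  have hE : MeasurableSet {z : ℝ × ℝ | ⌊u + m * z.2⌋ = ⌊u + m * z.1⌋} :=
    measurableSet_eq_fun (hfl.comp measurable_snd) (hfl.comp measurable_fst)
  have h1 : ∀ x, ENNReal.ofReal (binDensity μ u m x * |x| ^ s)
      = ∫⁻ y, {z : ℝ × ℝ | ⌊u + m * z.2⌋ = ⌊u + m * z.1⌋}.indicator
        (fun z => ENNReal.ofReal (m * |z.1| ^ s)) (x, y) ∂μ := by
    intro x
    have : (fun y => {z : ℝ × ℝ | ⌊u + m * z.2⌋ = ⌊u + m * z.1⌋}.indicator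
        (fun z => ENNReal.ofReal (m * |z.1| ^ s)) (x, y))
        = (quantBin u m x).indicator fun _ => ENNReal.ofReal (m * |x| ^ s) := rfl
    have hms : MeasurableSet (quantBin u m x) := measurableSet_floor_preimage u m _
    rw [this, lintegral_indicator_const hms, binDensity,
      mul_right_comm, ENNReal.ofReal_mul (by positivity), ofReal_measureReal]
  simp_rw [h1]
  rw [lintegral_lintegral_swap]
  swap
  · exact (Measurable.indicator (by fun_prop) hE).aemeasurable
  calc ∫⁻ y, ∫⁻ x, {z : ℝ × ℝ | ⌊u + m * z.2⌋ = ⌊u + m * z.1⌋}.indicator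
        (fun z => ENNReal.ofReal (m * |z.1| ^ s)) (x, y) ∂volume ∂μ
      ≤ ∫⁻ y, ENNReal.ofReal (|y| ^ s + (1 / m) ^ s) ∂μ := by
        refine lintegral_mono fun y => ?_
        have hms : MeasurableSet (quantBin u m y) := measurableSet_floor_preimage u m _
        calc ∫⁻ x, {z : ℝ × ℝ | ⌊u + m * z.2⌋ = ⌊u + m * z.1⌋}.indicator
              (fun z => ENNReal.ofReal (m * |z.1| ^ s)) (x, y)
            ≤ ∫⁻ x, (quantBin u m y).indicator
              (fun _ => ENNReal.ofReal (m * (|y| ^ s + (1 / m) ^ s))) x := by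
              refine lintegral_mono fun x => ?_
              by_cases hx : x ∈ quantBin u m y
              · rw [Set.indicator_of_mem hx]
                refine (Set.indicator_le_self _ _ _).trans (ENNReal.ofReal_le_ofReal ?_)
                have h2 := abs_sub_le_of_mem_quantBin hm hx
                have h3 : |x| ≤ |y| + 1 / m := by
                  have := abs_add_le y (x - y)
                  rw [add_sub_cancel] at this
                  linarith
                gcongr
                exact (Real.rpow_le_rpow (abs_nonneg _) h3 hs.le).trans
                  (Real.rpow_add_le_add_rpow (abs_nonneg _) (by positivity) hs.le hs1)
              · rw [Set.indicator_of_notMem hx, Set.indicator_of_notMem]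
                exact fun h => hx (Eq.symm h)
          _ = _ := by
              rw [lintegral_indicator_const hms, quantBin, volume_floor_preimage hm,
                ← ENNReal.ofReal_mul (by positivity)]
              congr 1
              field_simp
    _ = _ := by
        simp_rw [ENNReal.ofReal_add (Real.rpow_nonneg (abs_nonneg _) s)
          (show (0 : ℝ) ≤ (1 / m) ^ s by positivity)]
        rw [lintegral_add_right _ measurable_const]
        simp

/-- A bin of mass q has length 1/m and constant density m q, so it contributes -q log (m q) to the
integral. Adding q log m and summing the masses to 1 gives the shift by log m. -/
theorem hasSum_negMulLog_bins (μ : Measure ℝ) [IsProbabilityMeasure μ] {u m : ℝ} (hm : 0 < m)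
    (hint : Integrable fun x => Real.negMulLog (binDensity μ u m x)) :
    HasSum (fun k : ℤ => Real.negMulLog (μ.real {y : ℝ | ⌊u + m * y⌋ = k}))
      ((∫ x, Real.negMulLog (binDensity μ u m x)) + Real.log m) := by
  have hd : Pairwise (Function.onFun Disjoint fun k : ℤ => {y : ℝ | ⌊u + m * y⌋ = k}) := by
    intro k l hkl
    refine Set.disjoint_left.2 fun y hy hy' => hkl ?_
    exact Eq.trans (Eq.symm hy) hy'
  have hun : ⋃ k : ℤ, {y : ℝ | ⌊u + m * y⌋ = k} = Set.univ := by
    ext y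
    simp
  have h1 := hasSum_integral_iUnion (μ := volume)
    (fun k : ℤ => measurableSet_floor_preimage u m k) hd hint.integrableOn
  rw [hun, setIntegral_univ] at h1
  have h2 : HasSum (fun k : ℤ => μ.real {y : ℝ | ⌊u + m * y⌋ = k}) 1 := by
    have := hasSum_integral_iUnion (μ := μ) (f := fun _ => (1 : ℝ))
      (fun k : ℤ => measurableSet_floor_preimage u m k) hd (integrable_const _).integrableOn
    rw [hun] at this
    simpa using this
  have h3 := h1.add (h2.mul_right (Real.log m))
  rw [one_mul] at h3
  refine h3.congr_fun fun k => ?_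
  have h4 : ∀ x ∈ {y : ℝ | ⌊u + m * y⌋ = k}, Real.negMulLog (binDensity μ u m x)
      = Real.negMulLog (m * μ.real {y : ℝ | ⌊u + m * y⌋ = k}) := by
    intro x hx
    rw [binDensity, quantBin, show ⌊u + m * x⌋ = k from hx]
  have hv : volume.real {y : ℝ | ⌊u + m * y⌋ = k} = 1 / m := by
    rw [Measure.real, volume_floor_preimage hm, ENNReal.toReal_ofReal (by positivity)]
  rw [setIntegral_congr_fun (measurableSet_floor_preimage u m k) h4, setIntegral_const, hv,
    Real.negMulLog_mul]
  simp only [Real.negMulLog, smul_eq_mul]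
  field_simp
  ring

/-! ### Smooth approximations of the indicator of an interval -/

/-- Smooth functions that vanish outside `(a, b)` and increase to its indicator function. -/
noncomputable def smoothPulse (a b : ℝ) (k : ℕ) (t : ℝ) : ℝ :=
  Real.smoothTransition ((k + 1) * (t - a)) * Real.smoothTransition ((k + 1) * (b - t))

theorem contDiff_smoothPulse (a b : ℝ) (k : ℕ) {n : ℕ∞} : ContDiff ℝ n (smoothPulse a b k) := by
  have h1 : ContDiff ℝ n fun t : ℝ => (k + 1) * (t - a) := by fun_prop
  have h2 : ContDiff ℝ n fun t : ℝ => (k + 1) * (b - t) := by fun_prop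
  exact (Real.smoothTransition.contDiff.comp h1).mul (Real.smoothTransition.contDiff.comp h2)

theorem continuous_smoothPulse (a b : ℝ) (k : ℕ) : Continuous (smoothPulse a b k) :=
  (contDiff_smoothPulse a b k (n := 0)).continuous

theorem smoothPulse_nonneg (a b : ℝ) (k : ℕ) (t : ℝ) : 0 ≤ smoothPulse a b k t :=
  mul_nonneg (Real.smoothTransition.nonneg _) (Real.smoothTransition.nonneg _)

theorem smoothPulse_le_one (a b : ℝ) (k : ℕ) (t : ℝ) : smoothPulse a b k t ≤ 1 :=
  mul_le_one₀ (Real.smoothTransition.le_one _) (Real.smoothTransition.nonneg _)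
    (Real.smoothTransition.le_one _)

theorem smoothPulse_eq_zero {a b t : ℝ} (k : ℕ) (h : t ∉ Set.Ioo a b) :
    smoothPulse a b k t = 0 := by
  have hk : (0 : ℝ) ≤ k + 1 := by positivity
  rcases le_or_gt t a with h1 | h1
  · rw [smoothPulse, Real.smoothTransition.zero_of_nonpos, zero_mul]
    exact mul_nonpos_of_nonneg_of_nonpos hk (by linarith)
  · have h2 : b ≤ t := by
      by_contra h3
      exact h ⟨h1, not_le.1 h3⟩
    rw [smoothPulse, mul_comm, Real.smoothTransition.zero_of_nonpos, zero_mul]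
    exact mul_nonpos_of_nonneg_of_nonpos hk (by linarith)

theorem hasCompactSupport_smoothPulse (a b : ℝ) (k : ℕ) :
    HasCompactSupport (smoothPulse a b k) :=
  HasCompactSupport.intro (isCompact_Icc (a := a) (b := b)) fun _ h =>
    smoothPulse_eq_zero k fun h' => h (Set.Ioo_subset_Icc_self h')

theorem tendsto_smoothPulse (a b t : ℝ) :
    Tendsto (fun k => smoothPulse a b k t) atTop
      (𝓝 ((Set.Ioo a b).indicator (fun _ => (1 : ℝ)) t)) := by
  by_cases h : t ∈ Set.Ioo a b
  · rw [Set.indicator_of_mem h]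
    have hlim : ∀ c : ℝ, 0 < c → ∀ᶠ k : ℕ in atTop, 1 ≤ ((k : ℝ) + 1) * c := by
      intro c hc
      have : Tendsto (fun k : ℕ => ((k : ℝ) + 1) * c) atTop atTop :=
        (tendsto_atTop_add_const_right _ _ tendsto_natCast_atTop_atTop).atTop_mul_const hc
      exact this.eventually_ge_atTop 1
    refine tendsto_const_nhds.congr' ?_
    filter_upwards [hlim _ (sub_pos.2 h.1), hlim _ (sub_pos.2 h.2)] with k h1 h2
    rw [smoothPulse, Real.smoothTransition.one_of_one_le h1,
      Real.smoothTransition.one_of_one_le h2, one_mul]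
  · rw [Set.indicator_of_notMem h]
    simp_rw [smoothPulse_eq_zero _ h]
    exact tendsto_const_nhds

/-- `smoothPulse` as a real Schwartz function. -/
noncomputable def schwartzPulse (a b : ℝ) (k : ℕ) : 𝓢(ℝ, ℝ) :=
  (hasCompactSupport_smoothPulse a b k).toSchwartzMap (contDiff_smoothPulse a b k)

theorem schwartzPulse_apply (a b : ℝ) (k : ℕ) (t : ℝ) :
    schwartzPulse a b k t = smoothPulse a b k t := rfl

/-! ### Inversion of integrable characteristic functions -/

/-- The density attached to a characteristic function `φ` by Fourier inversion. -/
noncomputable def inversionDensity (φ : ℝ → ℂ) (x : ℝ) : ℝ :=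
  (FourierTransform.fourier (fun t : ℝ => φ (2 * Real.pi * t)) x).re

theorem integrable_comp_two_pi_mul {φ : ℝ → ℂ} (h : Integrable φ) :
    Integrable fun t : ℝ => φ (2 * Real.pi * t) :=
  h.comp_mul_left' (by positivity)

theorem continuous_fourier_of_integrable {f : ℝ → ℂ} (h : Integrable f) :
    Continuous (FourierTransform.fourier f) :=
  VectorFourier.fourierIntegral_continuous Real.continuous_fourierChar
    (by exact continuous_inner) h

theorem continuous_inversionDensity {φ : ℝ → ℂ} (h : Integrable φ) :
    Continuous (inversionDensity φ) :=
  Complex.continuous_re.comp (continuous_fourier_of_integrable (integrable_comp_two_pi_mul h))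

/-- L¹ closeness of characteristic functions becomes uniform closeness of densities. The factor
1/(2π) of the inversion formula is simply bounded by 1. -/
theorem abs_inversionDensity_sub_le {φ χ : ℝ → ℂ} (hφ : Integrable φ) (hχ : Integrable χ) (x : ℝ) :
    |inversionDensity φ x - inversionDensity χ x| ≤ ∫ t, ‖φ t - χ t‖ := by
  have h1 : inversionDensity φ x - inversionDensity χ x =
      (FourierTransform.fourier (fun t : ℝ => φ (2 * Real.pi * t) - χ (2 * Real.pi * t)) x).re := by
    rw [inversionDensity, inversionDensity, ← Complex.sub_re]
    congr 1
    simp only [Real.fourier_eq]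
    rw [← integral_sub]
    · simp only [smul_sub]
    · exact (Real.fourierIntegral_convergent_iff x).2 (integrable_comp_two_pi_mul hφ)
    · exact (Real.fourierIntegral_convergent_iff x).2 (integrable_comp_two_pi_mul hχ)
  rw [h1]
  refine (Complex.abs_re_le_norm _).trans ((VectorFourier.norm_fourierIntegral_le_integral_norm
    _ _ _ _ _).trans ?_)
  rw [Measure.integral_comp_mul_left (fun t => ‖φ t - χ t‖), smul_eq_mul]
  refine mul_le_of_le_one_left (integral_nonneg fun _ => norm_nonneg _) ?_
  rw [abs_of_nonneg (by positivity)]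
  exact inv_le_one_of_one_le₀ (by linarith [Real.pi_gt_three])

/-- Parseval's identity, applied twice. Writing g as the transform of its inverse transform moves
the Fourier transform onto `μ`, which produces the characteristic function. A second exchange moves
it from g onto that function. -/
theorem integral_schwartz_eq_of_integrable_charFun (μ : Measure ℝ) [IsProbabilityMeasure μ]
    (hφ : Integrable (charFun μ)) (g : 𝓢(ℝ, ℂ)) :
    ∫ x, g x ∂μ
      = ∫ x, g x * FourierTransform.fourier (fun t : ℝ => charFun μ (2 * Real.pi * t)) x := by
  have h1 := VectorFourier.integral_fourierIntegral_smul_eq_flip (μ := μ) (ν := volume)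
    (e := Real.fourierChar) (L := innerₗ ℝ) (f := fun _ => (1 : ℂ))
    (g := (FourierTransformInv.fourierInv g : 𝓢(ℝ, ℂ))) Real.continuous_fourierChar
    (by exact continuous_inner) (integrable_const _)
    (SchwartzMap.integrable _)
  have h2 : ∀ x, VectorFourier.fourierIntegral Real.fourierChar volume (innerₗ ℝ).flip
      (FourierTransformInv.fourierInv g : 𝓢(ℝ, ℂ)) x = g x := by
    intro x
    have h3 : FourierTransform.fourier (FourierTransformInv.fourierInv g : 𝓢(ℝ, ℂ)) = g :=
      FourierTransform.fourier_fourierInv_eq g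
    conv_rhs => rw [← h3]
    rw [SchwartzMap.fourier_coe]
    rw [flip_innerₗ]
    rfl
  simp only [h2, one_smul] at h1
  rw [← h1]
  have h4 : ∀ ξ, VectorFourier.fourierIntegral Real.fourierChar μ (innerₗ ℝ)
      (fun _ => (1 : ℂ)) ξ = charFun μ (-(2 * Real.pi * ξ)) := by
    intro ξ
    rw [charFun_eq_fourierIntegral']
    congr 1
    simp only [smul_eq_mul]
    field_simp
  have h5 : ∀ ξ, (FourierTransformInv.fourierInv g : 𝓢(ℝ, ℂ)) ξ
      = FourierTransform.fourier (g : ℝ → ℂ) (-ξ) := by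
    intro ξ
    rw [SchwartzMap.fourierInv_coe, Real.fourierInv_eq_fourier_neg]
  simp only [h4, h5]
  -- The reflection cancels the opposite signs in the conventions of `charFun` and the Fourier
  -- transform.
  rw [← integral_neg_eq_self]
  simp only [neg_neg, mul_neg]
  have h6 := VectorFourier.integral_fourierIntegral_smul_eq_flip (μ := volume) (ν := volume)
    (e := Real.fourierChar) (L := innerₗ ℝ) (f := g)
    (g := fun t : ℝ => charFun μ (2 * Real.pi * t)) Real.continuous_fourierChar
    (by exact continuous_inner) (SchwartzMap.integrable _) (integrable_comp_two_pi_mul hφ)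
  rw [flip_innerₗ] at h6
  simp only [smul_eq_mul] at h6 ⊢
  rw [show (fun x => g x * FourierTransform.fourier (fun t : ℝ => charFun μ (2 * Real.pi * t)) x)
    = fun x => g x * VectorFourier.fourierIntegral Real.fourierChar volume (innerₗ ℝ)
      (fun t : ℝ => charFun μ (2 * Real.pi * t)) x from rfl, ← h6]
  refine integral_congr_ae (ae_of_all _ fun x => ?_)
  exact mul_comm _ _

theorem measureReal_Ioo_eq_of_integrable_charFun (μ : Measure ℝ) [IsProbabilityMeasure μ]
    (hφ : Integrable (charFun μ)) (a b : ℝ) :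
    μ.real (Set.Ioo a b) = ∫ x in Set.Ioo a b, inversionDensity (charFun μ) x := by
  have hc := continuous_inversionDensity hφ
  have h1 : ∀ k, ∫ x, smoothPulse a b k x ∂μ
      = ∫ x, smoothPulse a b k x * inversionDensity (charFun μ) x := by
    intro k
    have hcd : ContDiff ℝ ((⊤ : ℕ∞) : WithTop ℕ∞) fun t => (smoothPulse a b k t : ℂ) :=
      Complex.ofRealCLM.contDiff.comp (contDiff_smoothPulse a b k)
    have hcs : HasCompactSupport fun t => (smoothPulse a b k t : ℂ) :=
      (hasCompactSupport_smoothPulse a b k).comp_left Complex.ofReal_zero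
    have h := integral_schwartz_eq_of_integrable_charFun μ hφ (hcs.toSchwartzMap hcd)
    simp only [HasCompactSupport.toSchwartzMap_toFun] at h
    have h2 := congrArg Complex.re h
    rw [integral_complex_ofReal, Complex.ofReal_re] at h2
    rw [h2, ← RCLike.re_eq_complex_re, ← integral_re]
    · refine integral_congr_ae (ae_of_all _ fun x => ?_)
      simp [inversionDensity]
    · refine Continuous.integrable_of_hasCompactSupport ?_ hcs.mul_right
      exact hcd.continuous.mul (continuous_fourier_of_integrable (integrable_comp_two_pi_mul hφ))
  have h2 : Tendsto (fun k => ∫ x, smoothPulse a b k x ∂μ) atTop (𝓝 (μ.real (Set.Ioo a b))) := by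
    have := tendsto_integral_of_dominated_convergence (μ := μ) (fun _ => (1 : ℝ))
      (fun k => (continuous_smoothPulse a b k).aestronglyMeasurable) (integrable_const _)
      (fun k => ae_of_all _ fun x => by
        rw [Real.norm_eq_abs, abs_of_nonneg (smoothPulse_nonneg a b k x)]
        exact smoothPulse_le_one a b k x) (ae_of_all _ (tendsto_smoothPulse a b))
    rwa [integral_indicator_const _ measurableSet_Ioo, smul_eq_mul, mul_one] at this
  have h3 : Tendsto (fun k => ∫ x, smoothPulse a b k x * inversionDensity (charFun μ) x) atTop
      (𝓝 (∫ x in Set.Ioo a b, inversionDensity (charFun μ) x)) := by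
    rw [← integral_indicator measurableSet_Ioo]
    refine tendsto_integral_of_dominated_convergence
      ((Set.Icc a b).indicator fun x => |inversionDensity (charFun μ) x|)
      (fun k => ((continuous_smoothPulse a b k).mul hc).aestronglyMeasurable) ?_ ?_ ?_
    · rw [integrable_indicator_iff measurableSet_Icc]
      exact hc.abs.continuousOn.integrableOn_compact isCompact_Icc
    · refine fun k => ae_of_all _ fun x => ?_
      by_cases hx : x ∈ Set.Icc a b
      · rw [Set.indicator_of_mem hx, norm_mul, Real.norm_eq_abs, Real.norm_eq_abs,
          abs_of_nonneg (smoothPulse_nonneg a b k x)]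
        exact mul_le_of_le_one_left (abs_nonneg _) (smoothPulse_le_one a b k x)
      · rw [Set.indicator_of_notMem hx, smoothPulse_eq_zero k fun h =>
          hx (Set.Ioo_subset_Icc_self h)]
        simp
    · refine ae_of_all _ fun x => ?_
      have := (tendsto_smoothPulse a b x).mul_const (inversionDensity (charFun μ) x)
      convert this using 2
      by_cases hx : x ∈ Set.Ioo a b <;> simp [hx]
  simp_rw [h1] at h2
  exact tendsto_nhds_unique h2 h3

/-- A negative value would, by continuity, persist on a small interval and give that interval
negative mass. -/
theorem inversionDensity_nonneg (μ : Measure ℝ) [IsProbabilityMeasure μ]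
    (hφ : Integrable (charFun μ)) (x : ℝ) : 0 ≤ inversionDensity (charFun μ) x := by
  by_contra! h
  have hc := continuous_inversionDensity hφ
  obtain ⟨δ, hδ, hb⟩ := Metric.eventually_nhds_iff_ball.1
    ((hc.tendsto x).eventually_lt_const (show inversionDensity (charFun μ) x
      < inversionDensity (charFun μ) x / 2 by linarith))
  rw [Real.ball_eq_Ioo] at hb
  have h1 := measureReal_Ioo_eq_of_integrable_charFun μ hφ (x - δ) (x + δ)
  have h2 : ∫ y in Set.Ioo (x - δ) (x + δ), inversionDensity (charFun μ) y
      ≤ ∫ y in Set.Ioo (x - δ) (x + δ), inversionDensity (charFun μ) x / 2 := by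
    refine setIntegral_mono_on ?_ (by simp) measurableSet_Ioo fun y hy => (hb y hy).le
    exact (hc.continuousOn.integrableOn_compact isCompact_Icc).mono_set Set.Ioo_subset_Icc_self
  rw [setIntegral_const, smul_eq_mul, Measure.real, Real.volume_Ioo,
    ENNReal.toReal_ofReal (by linarith)] at h2
  have h3 : 0 ≤ μ.real (Set.Ioo (x - δ) (x + δ)) := measureReal_nonneg
  nlinarith

theorem eq_withDensity_inversionDensity (μ : Measure ℝ) [IsProbabilityMeasure μ]
    (hφ : Integrable (charFun μ)) :
    μ = volume.withDensity fun x => ENNReal.ofReal (inversionDensity (charFun μ) x) := by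
  have hc := continuous_inversionDensity hφ
  refine Real.measure_ext_Ioo_rat fun a b => ?_
  rw [withDensity_apply _ measurableSet_Ioo, ← ofReal_integral_eq_lintegral_ofReal
    ((hc.continuousOn.integrableOn_compact isCompact_Icc).mono_set Set.Ioo_subset_Icc_self)
    (ae_of_all _ (inversionDensity_nonneg μ hφ)),
    ← measureReal_Ioo_eq_of_integrable_charFun μ hφ, ofReal_measureReal]

/-! ### Fractional moments from the characteristic function -/

/-- The truncation inequality bounds the tail beyond r by the mean of 1 - φ over |t| ≤ 2/r, hence by
4C r^(-s). Asking only for the moment of order s/2 leaves r^(-s/2 - 1) to integrate at infinity. The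
bound `K` depends on `C` and `s` only, which is what makes it uniform over the family of laws. -/
theorem exists_lintegral_rpow_le_of_charFun {C s : ℝ} (hC : 0 ≤ C) (hs : 0 < s) (hs1 : s ≤ 1) :
    ∃ K : ℝ≥0∞, K ≠ ∞ ∧ ∀ μ : Measure ℝ, IsProbabilityMeasure μ →
      (∀ t : ℝ, |t| ≤ 1 → ‖1 - charFun μ t‖ ≤ C * |t| ^ s) →
      ∫⁻ x, ENNReal.ofReal (|x| ^ (s / 2)) ∂μ ≤ K := by
  refine ⟨ENNReal.ofReal (s / 2) * ((∫⁻ t in Set.Ioc (0 : ℝ) 2, ENNReal.ofReal (t ^ (s / 2 - 1)))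
    + ∫⁻ t in Set.Ioi (2 : ℝ), ENNReal.ofReal (4 * C * t ^ (-s / 2 - 1))), ?_, ?_⟩
  · refine ENNReal.mul_ne_top ENNReal.ofReal_ne_top (ENNReal.add_ne_top.2 ⟨?_, ?_⟩)
    · have := (intervalIntegral.intervalIntegrable_rpow' (a := 0) (b := 2) (r := s / 2 - 1)
        (by linarith)).1
      exact this.lintegral_lt_top.ne
    · have := (integrableOn_Ioi_rpow_of_lt (a := -s / 2 - 1) (c := 2) (by linarith)
        (by norm_num)).const_mul (4 * C)
      exact this.lintegral_lt_top.ne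
  intro μ hμ h
  -- From r = 2 on, the averaging window |t| ≤ 2/r lies in the range where the hypothesis holds.
  have htail : ∀ r : ℝ, 2 ≤ r → μ {x | r < |x|} ≤ ENNReal.ofReal (4 * C * r ^ (-s)) := by
    intro r hr
    have hr0 : 0 < r := by linarith
    have h1 := measureReal_abs_gt_le_integral_charFun (μ := μ) hr0
    have h2 : ‖∫ t in (-2 * r⁻¹)..(2 * r⁻¹), 1 - charFun μ t‖
        ≤ (C * (2 * r⁻¹) ^ s) * |2 * r⁻¹ - -2 * r⁻¹| := by
      refine intervalIntegral.norm_integral_le_of_norm_le_const fun t ht => ?_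
      have hp : 0 < r⁻¹ := by positivity
      rw [Set.uIoc_of_le (by linarith)] at ht
      have ht2 : |t| ≤ 2 * r⁻¹ := abs_le.2 ⟨by linarith [ht.1], ht.2⟩
      have h3 : 2 * r⁻¹ ≤ 1 := by
        rw [← div_eq_mul_inv, div_le_one hr0]
        exact hr
      refine (h t (ht2.trans h3)).trans ?_
      gcongr
    rw [← ofReal_measureReal]
    refine ENNReal.ofReal_le_ofReal (h1.trans ?_)
    have h4 : |2 * r⁻¹ - -2 * r⁻¹| = 4 * r⁻¹ := by
      rw [show 2 * r⁻¹ - -2 * r⁻¹ = 4 * r⁻¹ by ring, abs_of_pos (by positivity)]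
    rw [h4] at h2
    calc 2⁻¹ * r * ‖∫ t in (-2 * r⁻¹)..(2 * r⁻¹), 1 - charFun μ t‖
        ≤ 2⁻¹ * r * (C * (2 * r⁻¹) ^ s * (4 * r⁻¹)) := by gcongr
      _ = 2 * C * (2 ^ s * r ^ (-s)) := by
          rw [Real.mul_rpow (by norm_num) (by positivity), Real.inv_rpow hr0.le,
            Real.rpow_neg hr0.le]
          field_simp
          ring
      _ ≤ 2 * C * (2 ^ (1 : ℝ) * r ^ (-s)) := by
          gcongr
          norm_num
      _ = 4 * C * r ^ (-s) := by
          rw [Real.rpow_one]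
          ring
  rw [lintegral_rpow_eq_lintegral_meas_lt_mul μ (ae_of_all _ fun x => abs_nonneg x)
    (by fun_prop) (by positivity : 0 < s / 2)]
  gcongr
  rw [← Set.Ioc_union_Ioi_eq_Ioi (show (0 : ℝ) ≤ 2 by norm_num),
    lintegral_union measurableSet_Ioi (Set.disjoint_left.2 fun x hx hx' =>
      absurd hx.2 (not_le.2 hx'))]
  gcongr ?_ + ?_
  · refine lintegral_mono fun t => ?_
    exact mul_le_of_le_one_left zero_le prob_le_one
  · refine setLIntegral_mono (by fun_prop) fun t ht => ?_
    have ht0 : (0 : ℝ) < t := lt_trans (by norm_num) (Set.mem_Ioi.1 ht)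
    refine (mul_le_mul_left (htail t (le_of_lt ht)) _).trans ?_
    rw [← ENNReal.ofReal_mul (by positivity), mul_assoc, ← Real.rpow_add ht0]
    apply le_of_eq
    congr 3
    ring

/-! ### Entropy of independent, identically distributed discrete variables -/

/-- The product rule for `negMulLog` makes entropy additive once each factor has total mass 1, so
normalization and additivity go through the same induction. -/
theorem tsum_pi_prod_and_negMulLog {E : Type*} {p : E → ℝ} (h0 : ∀ x, 0 ≤ p x)
    (h1 : ∀ x, p x ≤ 1) (hs : ∑' x, ENNReal.ofReal (p x) = 1) (N : ℕ) :
    ∑' v : Fin N → E, ENNReal.ofReal (∏ j, p (v j)) = 1 ∧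
    ∑' v : Fin N → E, ENNReal.ofReal (Real.negMulLog (∏ j, p (v j)))
      = N * ∑' x, ENNReal.ofReal (Real.negMulLog (p x)) := by
  have hP0 : ∀ (n : ℕ) (v : Fin n → E), 0 ≤ ∏ j, p (v j) := fun n v =>
    Finset.prod_nonneg fun j _ => h0 _
  have hP1 : ∀ (n : ℕ) (v : Fin n → E), ∏ j, p (v j) ≤ 1 := fun n v =>
    Finset.prod_le_one (fun j _ => h0 _) fun j _ => h1 _
  induction N with
  | zero => simp
  | succ n ih =>
    have hsplit : ∀ F : (Fin (n + 1) → E) → ℝ≥0∞,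
        ∑' v, F v = ∑' (x : E) (v : Fin n → E), F (Fin.cons x v) := by
      intro F
      rw [← (Fin.consEquiv fun _ => E).tsum_eq, ENNReal.tsum_prod']
      rfl
    constructor
    · rw [hsplit]
      simp_rw [Fin.prod_univ_succ, Fin.cons_zero, Fin.cons_succ, ENNReal.ofReal_mul (h0 _),
        ENNReal.tsum_mul_left, ih.1, mul_one]
      exact hs
    · rw [hsplit]
      have h : ∀ (x : E) (v : Fin n → E),
          ENNReal.ofReal (Real.negMulLog (p x * ∏ j, p (v j)))
            = ENNReal.ofReal (∏ j, p (v j)) * ENNReal.ofReal (Real.negMulLog (p x))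
              + ENNReal.ofReal (p x) * ENNReal.ofReal (Real.negMulLog (∏ j, p (v j))) := by
        intro x v
        have hx := Real.negMulLog_nonneg (h0 x) (h1 x)
        have hv := Real.negMulLog_nonneg (hP0 n v) (hP1 n v)
        rw [Real.negMulLog_mul, ENNReal.ofReal_add (mul_nonneg (hP0 n v) hx)
          (mul_nonneg (h0 x) hv), ENNReal.ofReal_mul (hP0 n v), ENNReal.ofReal_mul (h0 x)]
      simp_rw [Fin.prod_univ_succ, Fin.cons_zero, Fin.cons_succ, h, ENNReal.tsum_add,
        ENNReal.tsum_mul_left, ENNReal.tsum_mul_right, ih.1, ih.2, one_mul, hs]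
      push_cast
      ring

/-! ### Entropy of quantized samples and of their windows -/

theorem measurable_quantize (m : ℝ) : Measurable (quantize m) := by
  unfold quantize
  have h : Measurable fun x : ℝ => ⌊1 / 2 + m * x⌋ :=
    Int.measurable_floor.comp (by fun_prop : Measurable fun y : ℝ => 1 / 2 + m * y)
  exact (measurable_const.mul ((measurable_from_top (f := fun k : ℤ => (k : ℝ))).comp h))

/-- Only the lattice points k/m carry mass, and `F 0 = 0` discards the other reals. A general `F`
serves both the total mass and the entropy. -/
theorem tsum_quantize_eq_tsum_floor {Ω : Type*} [MeasurableSpace Ω] (P : Measure Ω) {m : ℝ}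
    (hm : 0 < m) (W : Ω → ℝ) {F : ℝ → ℝ} (hF : F 0 = 0) :
    ∑' x : ℝ, ENNReal.ofReal (F (P.real ((fun ω => quantize m (W ω)) ⁻¹' {x})))
      = ∑' k : ℤ, ENNReal.ofReal (F (P.real {ω | ⌊1 / 2 + m * W ω⌋ = k})) := by
  have hinj : Function.Injective fun k : ℤ => 1 / m * (k : ℝ) := fun k l h =>
    Int.cast_injective (mul_left_cancel₀ (by positivity) h)
  have hpre : ∀ k : ℤ, (fun ω => quantize m (W ω)) ⁻¹' {1 / m * (k : ℝ)}
      = {ω | ⌊1 / 2 + m * W ω⌋ = k} := by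
    intro k
    ext ω
    rw [Set.mem_preimage, Set.mem_singleton_iff]
    exact hinj.eq_iff (a := ⌊1 / 2 + m * W ω⌋) (b := k)
  rw [← hinj.tsum_eq]
  · simp_rw [hpre]
  · intro x hx
    by_contra hx'
    apply hx
    have : (fun ω => quantize m (W ω)) ⁻¹' {x} = ∅ := by
      ext ω
      simp only [Set.mem_preimage, Set.mem_singleton_iff, Set.mem_empty_iff_false, iff_false]
      rintro rfl
      exact hx' ⟨_, rfl⟩
    simp [this, hF]

theorem tsum_measureReal_floor {Ω : Type*} [MeasurableSpace Ω] (P : Measure Ω)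
    [IsProbabilityMeasure P] {W : Ω → ℝ} (hW : Measurable W) (m : ℝ) :
    ∑' k : ℤ, ENNReal.ofReal (P.real {ω | ⌊1 / 2 + m * W ω⌋ = k}) = 1 := by
  have hfl : Measurable fun ω => ⌊1 / 2 + m * W ω⌋ :=
    Int.measurable_floor.comp (measurable_const.add (measurable_const.mul hW))
  have h : ∀ k : ℤ, ENNReal.ofReal (P.real {ω | ⌊1 / 2 + m * W ω⌋ = k})
      = P {ω | ⌊1 / 2 + m * W ω⌋ = k} := fun k => ofReal_measureReal
  simp_rw [h]
  rw [← measure_iUnion]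
  · rw [← measure_univ (μ := P)]
    congr 1
    ext ω
    simp
  · intro k l hkl
    refine Set.disjoint_left.2 fun ω h h' => hkl (Eq.trans (Eq.symm h) h')
  · exact fun k => hfl (measurableSet_singleton k)

theorem discreteEntropy_quantize_eq {Ω : Type*} [MeasurableSpace Ω] (P : Measure Ω) {m : ℝ}
    (hm : 0 < m) (W : Ω → ℝ) :
    discreteEntropy P (fun ω => quantize m (W ω))
      = ∑' k : ℤ, ENNReal.ofReal (Real.negMulLog (P.real {ω | ⌊1 / 2 + m * W ω⌋ = k})) :=
  tsum_quantize_eq_tsum_floor P hm W Real.negMulLog_zero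

/-- Up to a constant the index is n i + j with j < n, so division with remainder recovers the block
i and the position j. -/
theorem sample_index_injective (n T : ℕ) : Function.Injective fun a : Fin (2 * T) × Fin n =>
    (n : ℤ) * ((-(T : ℤ) + 1 + (a.1 : ℕ)) - 1) + 1 + (a.2 : ℕ) := by
  rintro ⟨i, j⟩ ⟨i', j'⟩ h
  simp only at h
  have hj : ((j : ℕ) : ℤ) < n := by exact_mod_cast j.2
  have hj' : ((j' : ℕ) : ℤ) < n := by exact_mod_cast j'.2
  have h1 : (n : ℤ) * (i : ℕ) + (j : ℕ) = (n : ℤ) * (i' : ℕ) + (j' : ℕ) := by linarith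
  have h2 : n * (i : ℕ) + j = n * (i' : ℕ) + j' := by exact_mod_cast h1
  have hn : 0 < n := lt_of_le_of_lt (Nat.zero_le _) j.2
  have h3 : (i : ℕ) = i' := by
    have := congrArg (· / n) h2
    simpa [Nat.mul_add_div hn, Nat.div_eq_of_lt j.2, Nat.div_eq_of_lt j'.2] using this
  have h4 : (j : ℕ) = j' := by
    have := congrArg (· % n) h2
    simpa [Nat.mod_eq_of_lt j.2, Nat.mod_eq_of_lt j'.2] using this
  exact Prod.ext (Fin.ext h3) (Fin.ext h4)

theorem discreteEntropy_quantWindow {Ω : Type*} [MeasurableSpace Ω] (P : Measure Ω)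
    [IsProbabilityMeasure P] {R : ℤ → Ω → ℝ} (hR : ∀ i, Measurable (R i)) (hind : iIndepFun R P)
    (hid : ∀ i, P.map (R i) = P.map (R 1)) {m : ℝ} (hm : 0 < m) (n T : ℕ) :
    discreteEntropy P (quantWindow m n R T)
      = (2 * T : ℕ) * (n * discreteEntropy P (fun ω => quantize m (R 1 ω))) := by
  set p : ℝ → ℝ := fun x => P.real ((fun ω => quantize m (R 1 ω)) ⁻¹' {x}) with hp
  have hp0 : ∀ x, 0 ≤ p x := fun x => measureReal_nonneg
  have hp1 : ∀ x, p x ≤ 1 := fun x => measureReal_le_one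
  have hps : ∑' x, ENNReal.ofReal (p x) = 1 := by
    refine (tsum_quantize_eq_tsum_floor P hm (R 1) (F := id) rfl).trans ?_
    exact tsum_measureReal_floor P (hR 1) m
  have hpi : ∀ i x, P (R i ⁻¹' (quantize m ⁻¹' {x})) = ENNReal.ofReal (p x) := by
    intro i x
    have hms : MeasurableSet (quantize m ⁻¹' {x}) :=
      measurable_quantize m (measurableSet_singleton x)
    rw [← Measure.map_apply (hR i) hms, hid i, Measure.map_apply (hR 1) hms, hp,
      ofReal_measureReal]
    rfl
  have hV : ∀ v : Fin (2 * T) → Fin n → ℝ,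
      P.real (quantWindow m n R T ⁻¹' {v}) = ∏ i, ∏ j, p (v i j) := by
    intro v
    have hset : quantWindow m n R T ⁻¹' {v} = ⋂ a ∈ (Finset.univ : Finset (Fin (2 * T) × Fin n)),
        R ((n : ℤ) * ((-(T : ℤ) + 1 + (a.1 : ℕ)) - 1) + 1 + (a.2 : ℕ)) ⁻¹'
          (quantize m ⁻¹' {v a.1 a.2}) := by
      ext ω
      simp only [Set.mem_preimage, Set.mem_singleton_iff, Set.mem_iInter, Finset.mem_univ,
        forall_const]
      rw [funext_iff]
      simp only [funext_iff, Prod.forall]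
      rfl
    rw [Measure.real, hset, (hind.precomp (sample_index_injective n T)).measure_inter_preimage_eq_mul
      Finset.univ fun a _ => measurable_quantize m (measurableSet_singleton _)]
    simp_rw [hpi]
    rw [ENNReal.toReal_prod, Fintype.prod_prod_type]
    simp_rw [ENNReal.toReal_ofReal (hp0 _)]
  have hb := tsum_pi_prod_and_negMulLog hp0 hp1 hps n
  -- The tensorization is used a second time, now with whole blocks of n samples as letters.
  have hw := tsum_pi_prod_and_negMulLog (p := fun w : Fin n → ℝ => ∏ j, p (w j))
    (fun w => Finset.prod_nonneg fun j _ => hp0 _)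
    (fun w => Finset.prod_le_one (fun j _ => hp0 _) fun j _ => hp1 _) hb.1 (2 * T)
  rw [hb.2] at hw
  rw [discreteEntropy]
  simp_rw [hV]
  exact hw.2

theorem tendsto_windowEntropyRate {Ω : Type*} [MeasurableSpace Ω] (P : Measure Ω)
    [IsProbabilityMeasure P] {R : ℤ → Ω → ℝ} (hR : ∀ i, Measurable (R i)) (hind : iIndepFun R P)
    (hid : ∀ i, P.map (R i) = P.map (R 1)) {m : ℝ} (hm : 0 < m) (n : ℕ) :
    Tendsto (windowEntropyRate P m n R) atTop
      (𝓝 (n * discreteEntropy P (fun ω => quantize m (R 1 ω)))) := by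
  refine tendsto_const_nhds.congr' ?_
  -- The rate is constant in T once T ≥ 1; only the empty window T = 0, where the quotient is 0 / 0,
  -- is excluded.
  filter_upwards [eventually_ge_atTop 1] with T hT
  rw [windowEntropyRate, discreteEntropy_quantWindow P hR hind hid hm]
  have h1 : ((2 * T : ℕ) : ℝ≥0∞) ≠ 0 := by
    exact_mod_cast (by omega : 2 * T ≠ 0)
  have h2 : (2 * (T : ℝ≥0∞)) = ((2 * T : ℕ) : ℝ≥0∞) := by push_cast; ring
  rw [h2, ENNReal.mul_div_right_comm, ENNReal.div_self h1 (ENNReal.natCast_ne_top _), one_mul]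

/-! ### Convergence in probability -/

/-- The truncation inequality bounds P(|U| > ε/2) by an integral of 1 - φ over a fixed interval, and
dominated convergence applies there. -/
theorem tendstoInMeasure_zero_of_tendsto_charFun {Ω : Type*} [MeasurableSpace Ω] {P : Measure Ω}
    [IsProbabilityMeasure P] {ι : Type*} {l : Filter ι} [l.IsCountablyGenerated]
    {U : ι → Ω → ℝ} (hU : ∀ i, Measurable (U i))
    (h : ∀ t, Tendsto (fun i => charFun (P.map (U i)) t) l (𝓝 1)) :
    TendstoInMeasure P U l 0 := by
  rw [tendstoInMeasure_iff_norm]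
  intro ε hε
  have hpr : ∀ i, IsProbabilityMeasure (P.map (U i)) := fun i =>
    Measure.isProbabilityMeasure_map (hU i).aemeasurable
  have h1 : Tendsto (fun i => ∫ t in (-2 * (ε / 2)⁻¹)..(2 * (ε / 2)⁻¹),
      1 - charFun (P.map (U i)) t) l (𝓝 0) := by
    have := intervalIntegral.tendsto_integral_filter_of_dominated_convergence (l := l)
      (μ := volume) (a := -2 * (ε / 2)⁻¹) (b := 2 * (ε / 2)⁻¹)
      (F := fun i t => 1 - charFun (P.map (U i)) t) (f := fun _ => 0) (fun _ => 2)
      (Eventually.of_forall fun i => by fun_prop)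
      (Eventually.of_forall fun i => ae_of_all _ fun t _ => norm_one_sub_charFun_le_two)
      (by simp) (ae_of_all _ fun t _ => by simpa using (h t).const_sub 1)
    simpa using this
  have h2 : Tendsto (fun i => ENNReal.ofReal (2⁻¹ * (ε / 2) *
      ‖∫ t in (-2 * (ε / 2)⁻¹)..(2 * (ε / 2)⁻¹), 1 - charFun (P.map (U i)) t‖)) l (𝓝 0) := by
    have := (ENNReal.continuous_ofReal.tendsto _).comp (h1.norm.const_mul (2⁻¹ * (ε / 2)))
    rw [norm_zero, mul_zero, ENNReal.ofReal_zero] at this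
    exact this
  refine tendsto_of_tendsto_of_tendsto_of_le_of_le tendsto_const_nhds h2 (fun _ => zero_le)
    fun i => ?_
  -- The level is halved because the truncation inequality controls a strict tail, whereas
  -- convergence in measure asks for ε ≤ |U|.
  have h3 := measureReal_abs_gt_le_integral_charFun (μ := P.map (U i)) (half_pos hε)
  refine le_trans ?_ (ENNReal.ofReal_le_ofReal h3)
  have hms : MeasurableSet {x : ℝ | ε / 2 < |x|} :=
    measurableSet_lt measurable_const measurable_norm
  rw [ofReal_measureReal, Measure.map_apply (hU i) hms]
  refine measure_mono fun ω hω => ?_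
  have hω' : ε ≤ ‖U i ω - (0 : Ω → ℝ) ω‖ := hω
  rw [Pi.zero_apply, sub_zero, Real.norm_eq_abs] at hω'
  change ε / 2 < |U i ω|
  linarith

theorem tendstoInMeasure_add_real {Ω : Type*} [MeasurableSpace Ω] {P : Measure Ω} {ι : Type*}
    {l : Filter ι} {U V : ι → Ω → ℝ} {A B : Ω → ℝ} (hU : TendstoInMeasure P U l A)
    (hV : TendstoInMeasure P V l B) :
    TendstoInMeasure P (fun i ω => U i ω + V i ω) l (fun ω => A ω + B ω) := by
  rw [tendstoInMeasure_iff_norm] at *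
  intro ε hε
  have h := (hU (ε / 2) (half_pos hε)).add (hV (ε / 2) (half_pos hε))
  rw [add_zero] at h
  refine tendsto_of_tendsto_of_tendsto_of_le_of_le tendsto_const_nhds h (fun _ => zero_le)
    fun i => le_trans (measure_mono fun ω hω => ?_) (measure_union_le _ _)
  have hω' : ε ≤ ‖U i ω + V i ω - (A ω + B ω)‖ := hω
  by_contra hn
  rw [Set.mem_union, not_or] at hn
  have h1 : ‖U i ω - A ω‖ < ε / 2 := not_le.1 hn.1
  have h2 : ‖V i ω - B ω‖ < ε / 2 := not_le.1 hn.2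
  have h3 := norm_add_le (U i ω - A ω) (V i ω - B ω)
  rw [show U i ω - A ω + (V i ω - B ω) = U i ω + V i ω - (A ω + B ω) by ring] at h3
  linarith

theorem tendstoInMeasure_const_mul_real {Ω : Type*} [MeasurableSpace Ω] {P : Measure Ω}
    {ι : Type*} {l : Filter ι} {U : ι → Ω → ℝ} {A : Ω → ℝ} (hU : TendstoInMeasure P U l A)
    (c : ℝ) : TendstoInMeasure P (fun i ω => c * U i ω) l (fun ω => c * A ω) := by
  rw [tendstoInMeasure_iff_norm] at *
  intro ε hε
  refine tendsto_of_tendsto_of_tendsto_of_le_of_le tendsto_const_nhds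
    (hU (ε / (|c| + 1)) (by positivity)) (fun _ => zero_le)
    fun i => measure_mono fun ω hω => ?_
  have hω' : ε ≤ ‖c * U i ω - c * A ω‖ := hω
  change ε / (|c| + 1) ≤ ‖U i ω - A ω‖
  rw [← mul_sub, norm_mul, Real.norm_eq_abs c] at hω'
  rw [div_le_iff₀ (by positivity)]
  nlinarith [norm_nonneg (U i ω - A ω)]

theorem tendstoInMeasure_sum_real {Ω : Type*} [MeasurableSpace Ω] {P : Measure Ω} {κ ι : Type*}
    {l : Filter ι} {U : κ → ι → Ω → ℝ} {A : κ → Ω → ℝ}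
    (h : ∀ j, TendstoInMeasure P (U j) l (A j)) (s : Finset κ) :
    TendstoInMeasure P (fun i ω => ∑ j ∈ s, U j i ω) l (fun ω => ∑ j ∈ s, A j ω) := by
  classical
  induction s using Finset.induction_on with
  | empty =>
    rw [tendstoInMeasure_iff_norm]
    intro ε hε
    simpa [not_le.2 hε] using tendsto_const_nhds
  | insert j s hj ih =>
    simp only [Finset.sum_insert hj]
    exact tendstoInMeasure_add_real (h j) ih

theorem tendsto_integral_exp_of_tendstoInMeasure {Ω : Type*} [MeasurableSpace Ω] {P : Measure Ω}
    [IsProbabilityMeasure P] {U : ℕ → Ω → ℝ} {A : Ω → ℝ} (hU : ∀ k, Measurable (U k))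
    (h : TendstoInMeasure P U atTop A) :
    Tendsto (fun k => ∫ ω, Complex.exp (Complex.I * (U k ω : ℂ)) ∂P) atTop
      (𝓝 (∫ ω, Complex.exp (Complex.I * (A ω : ℂ)) ∂P)) := by
  refine tendsto_of_subseq_tendsto fun ns hns => ?_
  obtain ⟨ms, -, hms⟩ := (h.comp hns).exists_seq_tendsto_ae
  refine ⟨ms, tendsto_integral_of_dominated_convergence (fun _ => (1 : ℝ)) (fun k => ?_)
    (integrable_const _) (fun k => ae_of_all _ fun ω => ?_) ?_⟩
  · have := hU (ns (ms k))
    fun_prop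
  · rw [mul_comm, Complex.norm_exp_ofReal_mul_I]
  · filter_upwards [hms] with ω hω
    have hc : Continuous fun x : ℝ => Complex.exp (Complex.I * (x : ℂ)) := by fun_prop
    exact (hc.tendsto _).comp hω

/-- A sequence that is Cauchy in probability has an almost surely convergent subsequence. -/
theorem exists_subseq_tendsto_ae_of_cauchy {Ω : Type*} [MeasurableSpace Ω] {P : Measure Ω}
    {U : ℕ → Ω → ℝ} (hU : ∀ k, Measurable (U k))
    (h : TendstoInMeasure P (fun (q : ℕ × ℕ) ω => U q.1 ω - U q.2 ω) atTop 0) :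
    ∃ (ns : ℕ → ℕ) (R : Ω → ℝ), StrictMono ns ∧ Measurable R ∧
      ∀ᵐ ω ∂P, Tendsto (fun j => U (ns j) ω) atTop (𝓝 (R ω)) := by
  rw [tendstoInMeasure_iff_norm] at h
  have hN : ∀ j : ℕ, ∃ N, ∀ k ≥ N, ∀ i ≥ k,
      P {ω | (1 / 2 : ℝ) ^ j ≤ |U k ω - U i ω|} ≤ ENNReal.ofReal ((1 / 2) ^ j) := by
    intro j
    have h1 := ENNReal.tendsto_nhds_zero.1 (h ((1 / 2) ^ j) (by positivity))
      (ENNReal.ofReal ((1 / 2) ^ j)) (by positivity)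
    obtain ⟨⟨a, b⟩, hab⟩ := eventually_atTop.1 h1
    refine ⟨max a b, fun k hk i hi => ?_⟩
    have := hab (k, i) ⟨le_trans (le_max_left _ _) hk, le_trans (le_max_right _ _) (hk.trans hi)⟩
    simpa using this
  obtain ⟨ns, hns, hb⟩ := extraction_forall_of_eventually' hN
  -- Borel–Cantelli: almost surely the increments along the subsequence are eventually below a
  -- geometric sequence, hence summable.
  have hbc : ∀ᵐ ω ∂P, ∀ᶠ j in atTop,
      ω ∉ {ω | (1 / 2 : ℝ) ^ j ≤ |U (ns j) ω - U (ns (j + 1)) ω|} := by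
    refine ae_eventually_notMem (ne_top_of_le_ne_top ?_ (ENNReal.tsum_le_tsum fun j =>
      hb j (ns (j + 1)) (hns.monotone (Nat.le_succ j))))
    exact summable_geometric_two.tsum_ofReal_ne_top
  have hlim : ∀ᵐ ω ∂P, ∃ x, Tendsto (fun j => U (ns j) ω) atTop (𝓝 x) := by
    filter_upwards [hbc] with ω hω
    refine cauchySeq_tendsto_of_complete (cauchySeq_of_summable_dist ?_)
    refine Summable.of_norm_bounded_eventually_nat summable_geometric_two ?_
    filter_upwards [hω] with j hj
    rw [Real.norm_of_nonneg dist_nonneg, Real.dist_eq]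
    exact (not_le.1 hj).le
  obtain ⟨R, hR, hRl⟩ := measurable_limit_of_tendsto_metrizable_ae
    (fun j => (hU (ns j)).aemeasurable) hlim
  exact ⟨ns, R, hns, hR, hRl⟩

/-! ### White noises paired with indicator functions of intervals -/

theorem measurable_eval_distribution (φ : 𝓢(ℝ, ℝ)) :
    Measurable fun x : RealTemperedDistribution => x φ :=
  Measurable.mono (comap_measurable _)
    (le_iSup (fun φ : 𝓢(ℝ, ℝ) => MeasurableSpace.comap
      (fun x : RealTemperedDistribution => x φ) inferInstance) φ) le_rfl

/-- Only continuity of `f` at 0 and boundedness on [-C, C] are available. Where |d| < δ the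
integrand is at most η on a fixed interval; where |d| ≥ δ it is at most (M/δ)|d|, which is small in
L¹. -/
theorem tendsto_integral_comp_of_tendsto_L1 {ι : Type*} {l : Filter ι} {f : ℝ → ℂ}
    (hf : Continuous f) (hf0 : f 0 = 0) {d : ι → ℝ → ℝ} (hd : ∀ i, Continuous (d i)) {C K : ℝ}
    (hC : ∀ i t, |d i t| ≤ C) (hK : ∀ i t, K < |t| → d i t = 0)
    (hL : Tendsto (fun i => ∫⁻ t, ‖d i t‖ₑ) l (𝓝 0)) :
    Tendsto (fun i => ∫ t, f (d i t)) l (𝓝 0) := by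
  have hsupp : ∀ i t, t ∉ Set.Icc (-K) K → d i t = 0 := by
    intro i t ht
    refine hK i t ?_
    by_contra! h
    exact ht (abs_le.1 h)
  have hcs : ∀ i, HasCompactSupport (d i) := fun i =>
    HasCompactSupport.intro isCompact_Icc fun t => hsupp i t
  have hint : ∀ i, Integrable (d i) := fun i => (hd i).integrable_of_hasCompactSupport (hcs i)
  have hL' : Tendsto (fun i => ∫ t, |d i t|) l (𝓝 0) := by
    have h1 : ∀ i, ∫ t, |d i t| = (∫⁻ t, ‖d i t‖ₑ).toReal := fun i => by
      rw [← integral_norm_eq_lintegral_enorm (hint i).aestronglyMeasurable]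
      rfl
    simp_rw [h1]
    exact (ENNReal.tendsto_toReal ENNReal.zero_ne_top).comp hL
  obtain ⟨M, hM⟩ := (isCompact_Icc (a := -C) (b := C)).exists_bound_of_continuousOn hf.continuousOn
  rw [Metric.tendsto_nhds]
  intro ε hε
  set η : ℝ := ε / (2 * (2 * |K| + 1)) with hη
  have hη0 : 0 < η := by positivity
  obtain ⟨δ, hδ, hfδ⟩ := Metric.continuousAt_iff.1 hf.continuousAt η hη0
  have hM0 : 0 ≤ |M| / δ := by positivity
  have hpt : ∀ i t, ‖f (d i t)‖ ≤ (Set.Icc (-|K|) |K|).indicator (fun _ => η) t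
      + |M| / δ * |d i t| := by
    intro i t
    have hpos : 0 ≤ (Set.Icc (-|K|) |K|).indicator (fun _ => η) t :=
      Set.indicator_nonneg (fun _ _ => hη0.le) t
    by_cases h0 : d i t = 0
    · rw [h0, hf0]
      simpa using hpos
    rcases lt_or_ge |d i t| δ with h | h
    · have ht : t ∈ Set.Icc (-|K|) |K| := by
        by_contra hn
        refine h0 (hsupp i t fun h' => hn ⟨?_, h'.2.trans (le_abs_self K)⟩)
        linarith [h'.1, le_abs_self K]
      rw [Set.indicator_of_mem ht]
      have := hfδ (x := d i t) (by rwa [Real.dist_eq, sub_zero])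
      rw [hf0, dist_zero_right] at this
      have h2 : 0 ≤ |M| / δ * |d i t| := by positivity
      linarith
    · have h1 : ‖f (d i t)‖ ≤ |M| := (hM _ (abs_le.1 (hC i t))).trans (le_abs_self M)
      have h2 : |M| ≤ |M| / δ * |d i t| := by
        rw [div_mul_eq_mul_div, le_div_iff₀ hδ]
        gcongr
      linarith
  have hIi : Integrable ((Set.Icc (-|K|) |K|).indicator fun _ : ℝ => η) :=
    (integrable_indicator_iff measurableSet_Icc).2 (by simp)
  have hev := (hL'.const_mul (|M| / δ)).eventually_lt_const
    (show |M| / δ * 0 < ε / 2 by rw [mul_zero]; positivity)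
  filter_upwards [hev] with i hi
  rw [dist_zero_right]
  calc ‖∫ t, f (d i t)‖ ≤ ∫ t, ((Set.Icc (-|K|) |K|).indicator (fun _ => η) t
          + |M| / δ * |d i t|) :=
        norm_integral_le_of_norm_le (hIi.add ((hint i).abs.const_mul _))
          (ae_of_all _ (hpt i))
    _ = 2 * |K| * η + |M| / δ * ∫ t, |d i t| := by
        rw [integral_add hIi ((hint i).abs.const_mul _), integral_const_mul,
          integral_indicator_const _ measurableSet_Icc, Measure.real, Real.volume_Icc,
          ENNReal.toReal_ofReal (by linarith [abs_nonneg K]), smul_eq_mul]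
        ring
    _ < ε / 2 + ε / 2 := by
        refine add_lt_add_of_le_of_lt ?_ hi
        rw [hη, mul_div_assoc', div_le_div_iff₀ (by positivity) (by positivity)]
        nlinarith [abs_nonneg K]
    _ = ε := add_halves ε

section WhiteNoise

variable {Ω : Type*} [MeasurableSpace Ω] {P : Measure Ω} [IsProbabilityMeasure P]
  {X : Ω → RealTemperedDistribution} {f : ℝ → ℂ}

theorem measurable_pairing (hX : Measurable X) (φ : 𝓢(ℝ, ℝ)) : Measurable fun ω => X ω φ :=
  (measurable_eval_distribution φ).comp hX

/-- By linearity, the characteristic function of ⟨X, d⟩ at u is the characteristic functional at u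
d, and its exponent tends to 0. The functional is assumed known on compactly supported functions
only, which suffices here and spares growth conditions on `f`. -/
theorem tendstoInMeasure_pairing_zero (hX : Measurable X) (hf : Continuous f) (hf0 : f 0 = 0)
    (hE : ∀ φ : 𝓢(ℝ, ℝ), HasCompactSupport φ →
      ∫ ω, Complex.exp (Complex.I * ((X ω φ : ℝ) : ℂ)) ∂P = Complex.exp (∫ t : ℝ, f (φ t)))
    {ι : Type*} {l : Filter ι} [l.IsCountablyGenerated] {d : ι → 𝓢(ℝ, ℝ)} {C K : ℝ}
    (hC : ∀ i t, |d i t| ≤ C) (hK : ∀ i t, K < |t| → d i t = 0)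
    (hL : Tendsto (fun i => ∫⁻ t, ‖d i t‖ₑ) l (𝓝 0)) :
    TendstoInMeasure P (fun i ω => X ω (d i)) l 0 := by
  refine tendstoInMeasure_zero_of_tendsto_charFun (fun i => measurable_pairing hX _) fun u => ?_
  have hcs : ∀ i, HasCompactSupport (u • d i) := by
    intro i
    refine HasCompactSupport.intro (isCompact_Icc (a := -K) (b := K)) fun t ht => ?_
    rw [smul_apply, hK i t, smul_zero]
    by_contra! h
    exact ht (abs_le.1 h)
  have h1 : ∀ i, charFun (P.map fun ω => X ω (d i)) u
      = Complex.exp (∫ t, f (u * d i t)) := by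
    intro i
    have h2 := hE (u • d i) (hcs i)
    simp only [map_smul, smul_apply, smul_eq_mul] at h2
    rw [← h2, charFun_apply_real, integral_map (measurable_pairing hX _).aemeasurable
      (by fun_prop)]
    refine integral_congr_ae (ae_of_all _ fun ω => ?_)
    simp only [Complex.ofReal_mul]
    ring_nf
  simp_rw [h1]
  have h3 := tendsto_integral_comp_of_tendsto_L1 (l := l) (f := fun w => f (u * w))
    (by fun_prop) (by simpa using hf0) (fun i => (d i).continuous) hC hK hL
  have h4 := (Complex.continuous_exp.tendsto 0).comp h3
  rwa [Complex.exp_zero] at h4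

theorem exists_isPairing (hX : Measurable X) (hf : Continuous f) (hf0 : f 0 = 0)
    (hE : ∀ φ : 𝓢(ℝ, ℝ), HasCompactSupport φ →
      ∫ ω, Complex.exp (Complex.I * ((X ω φ : ℝ) : ℂ)) ∂P = Complex.exp (∫ t : ℝ, f (φ t)))
    {g : ℝ → ℝ} (hg : Measurable g) {ψ : ℕ → 𝓢(ℝ, ℝ)} {C K : ℝ} (hC : ∀ k t, |ψ k t| ≤ C)
    (hK : ∀ k t, K < |t| → ψ k t = 0)
    (hL : Tendsto (fun k => ∫⁻ t : ℝ, ‖ψ k t - g t‖ₑ) atTop (𝓝 0)) :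
    ∃ R, IsPairing P X g R := by
  -- Any two approximations of g have asymptotically equal pairings. Indexed by ℕ × ℕ this is the
  -- Cauchy property; indexed by ℕ it shows that the limit does not depend on the sequence.
  have hdiff : ∀ {ι : Type} {l : Filter ι} [l.IsCountablyGenerated] (ψ₁ ψ₂ : ι → 𝓢(ℝ, ℝ))
      (C₁ K₁ C₂ K₂ : ℝ), (∀ k t, |ψ₁ k t| ≤ C₁) → (∀ k t, K₁ < |t| → ψ₁ k t = 0) →
      (∀ k t, |ψ₂ k t| ≤ C₂) → (∀ k t, K₂ < |t| → ψ₂ k t = 0) →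
      Tendsto (fun k => ∫⁻ t : ℝ, ‖ψ₁ k t - g t‖ₑ) l (𝓝 0) →
      Tendsto (fun k => ∫⁻ t : ℝ, ‖ψ₂ k t - g t‖ₑ) l (𝓝 0) →
      TendstoInMeasure P (fun k ω => X ω (ψ₁ k) - X ω (ψ₂ k)) l 0 := by
    intro ι l _ ψ₁ ψ₂ C₁ K₁ C₂ K₂ hC₁ hK₁ hC₂ hK₂ hL₁ hL₂
    have h := tendstoInMeasure_pairing_zero (P := P) hX hf hf0 hE (l := l)
      (d := fun k => ψ₁ k - ψ₂ k) (C := C₁ + C₂) (K := max K₁ K₂) ?_ ?_ ?_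
    · simpa only [map_sub] using h
    · intro k t
      rw [sub_apply]
      exact (abs_sub _ _).trans (add_le_add (hC₁ k t) (hC₂ k t))
    · intro k t ht
      rw [sub_apply, hK₁ k t (lt_of_le_of_lt (le_max_left _ _) ht),
        hK₂ k t (lt_of_le_of_lt (le_max_right _ _) ht), sub_zero]
    · have h1 := hL₁.add hL₂
      rw [add_zero] at h1
      refine tendsto_of_tendsto_of_tendsto_of_le_of_le tendsto_const_nhds h1 (fun _ => zero_le)
        fun k => ?_
      have hm : Measurable fun t => ‖ψ₁ k t - g t‖ₑ :=
        ((ψ₁ k).continuous.measurable.sub hg).enorm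
      rw [← lintegral_add_left hm]
      refine lintegral_mono fun t => ?_
      have := enorm_sub_le (a := ψ₁ k t - g t) (b := ψ₂ k t - g t)
      rwa [sub_sub_sub_cancel_right] at this
  have hcau := hdiff (ι := ℕ × ℕ) (l := atTop) (fun q => ψ q.1) (fun q => ψ q.2) C K C K
    (fun _ => hC _) (fun _ => hK _) (fun _ => hC _) (fun _ => hK _)
    (hL.comp (by rw [← prod_atTop_atTop_eq]; exact tendsto_fst))
    (hL.comp (by rw [← prod_atTop_atTop_eq]; exact tendsto_snd))
  obtain ⟨ns, R, hns, hR, hlim⟩ := exists_subseq_tendsto_ae_of_cauchy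
    (fun k => measurable_pairing hX (ψ k)) hcau
  refine ⟨R, hR, ?_⟩
  rintro χ ⟨C', hC'⟩ ⟨K', hK'⟩ hL'
  have h1 := hdiff (l := atTop) χ (fun k => ψ (ns k)) C' K' C K hC' hK' (fun _ => hC _)
    (fun _ => hK _) hL' (hL.comp hns.tendsto_atTop)
  have h2 : TendstoInMeasure P (fun k ω => X ω (ψ (ns k))) atTop R :=
    tendstoInMeasure_of_tendsto_ae
      (fun k => (measurable_pairing hX _).aestronglyMeasurable) hlim
  have h3 := tendstoInMeasure_add_real h1 h2
  simpa using h3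

theorem pulse_eq_indicator {n : ℕ} (hn : 1 ≤ n) (i : ℤ) (t : ℝ) :
    pulse (n * t - i + 1) = (Set.Ico (((i : ℝ) - 1) / n) (i / n)).indicator (fun _ => 1) t := by
  have hn0 : (0 : ℝ) < n := by exact_mod_cast hn
  have h : (n * t - i + 1 ∈ Set.Ico (0 : ℝ) 1) ↔ t ∈ Set.Ico (((i : ℝ) - 1) / n) (i / n) := by
    rw [Set.mem_Ico, Set.mem_Ico, div_le_iff₀ hn0, lt_div_iff₀ hn0]
    constructor <;> rintro ⟨h1, h2⟩ <;> constructor <;> linarith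
  by_cases ht : t ∈ Set.Ico (((i : ℝ) - 1) / n) (i / n)
  · rw [Set.indicator_of_mem ht, pulse, Set.indicator_of_mem (h.2 ht)]
  · rw [Set.indicator_of_notMem ht, pulse, Set.indicator_of_notMem (mt h.1 ht)]

theorem abs_schwartzPulse_le (a b : ℝ) (k : ℕ) (t : ℝ) : |schwartzPulse a b k t| ≤ 1 := by
  rw [schwartzPulse_apply, abs_of_nonneg (smoothPulse_nonneg a b k t)]
  exact smoothPulse_le_one a b k t

theorem schwartzPulse_eq_zero (a b : ℝ) (k : ℕ) (t : ℝ) (ht : max |a| |b| < |t|) :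
    schwartzPulse a b k t = 0 := by
  refine smoothPulse_eq_zero k fun h => not_le.2 ht ?_
  refine abs_le.2 ⟨?_, h.2.le.trans ((le_abs_self b).trans (le_max_right _ _))⟩
  have := le_max_left |a| |b|
  linarith [neg_abs_le a, h.1]

theorem tendsto_lintegral_schwartzPulse_sub (a b : ℝ) :
    Tendsto (fun k => ∫⁻ t, ‖schwartzPulse a b k t
      - (Set.Ico a b).indicator (fun _ => (1 : ℝ)) t‖ₑ) atTop (𝓝 0) := by
  have h := tendsto_lintegral_of_dominated_convergence (μ := volume)
    (F := fun k t => ‖schwartzPulse a b k t - (Set.Ico a b).indicator (fun _ => (1 : ℝ)) t‖ₑ)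
    (f := fun _ => 0) ((Set.Icc a b).indicator fun _ => 2) ?_ ?_ ?_ ?_
  · simpa using h
  · intro k
    exact ((schwartzPulse a b k).continuous.measurable.sub
      (measurable_const.indicator measurableSet_Ico)).enorm
  · refine fun k => ae_of_all _ fun t => ?_
    by_cases ht : t ∈ Set.Icc a b
    · rw [Set.indicator_of_mem ht]
      refine enorm_sub_le.trans ?_
      rw [← one_add_one_eq_two]
      gcongr
      · rw [Real.enorm_eq_ofReal_abs, ← ENNReal.ofReal_one]
        exact ENNReal.ofReal_le_ofReal (abs_schwartzPulse_le a b k t)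
      · rw [enorm_indicator_eq_indicator_enorm]
        refine (Set.indicator_le_self _ _ _).trans ?_
        simp
    · simp only
      rw [Set.indicator_of_notMem ht, schwartzPulse_apply, smoothPulse_eq_zero k fun h' =>
        ht (Set.Ioo_subset_Icc_self h'), Set.indicator_of_notMem fun h' =>
        ht (Set.Ico_subset_Icc_self h')]
      simp
  · rw [lintegral_indicator_const measurableSet_Icc]
    simp [ENNReal.mul_eq_top]
  -- The smooth pulses converge to the indicator of the open interval, which differs from that of
  -- [a, b) only at a.
  · have : ∀ᵐ t : ℝ, t ≠ a := by simp [ae_iff, measure_singleton]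
    filter_upwards [this] with t ht
    have h1 := (((tendsto_smoothPulse a b t).sub_const
      ((Set.Ico a b).indicator (fun _ => (1 : ℝ)) t))).enorm
    have h2 : (Set.Ioo a b).indicator (fun _ => (1 : ℝ)) t
        = (Set.Ico a b).indicator (fun _ => (1 : ℝ)) t := by
      have : t ∈ Set.Ioo a b ↔ t ∈ Set.Ico a b :=
        ⟨fun h => ⟨h.1.le, h.2⟩, fun h => ⟨lt_of_le_of_ne h.1 (Ne.symm ht), h.2⟩⟩
      by_cases h : t ∈ Set.Ico a b
      · rw [Set.indicator_of_mem h, Set.indicator_of_mem (this.2 h)]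
      · rw [Set.indicator_of_notMem h, Set.indicator_of_notMem (mt this.1 h)]
    rw [h2, sub_self, enorm_zero] at h1
    exact h1

theorem exists_isPairing_pulse (hX : Measurable X) (hf : Continuous f) (hf0 : f 0 = 0)
    (hE : ∀ φ : 𝓢(ℝ, ℝ), HasCompactSupport φ →
      ∫ ω, Complex.exp (Complex.I * ((X ω φ : ℝ) : ℂ)) ∂P = Complex.exp (∫ t : ℝ, f (φ t)))
    {n : ℕ} (hn : 1 ≤ n) (i : ℤ) :
    ∃ R, IsPairing P X (fun t => pulse (n * t - i + 1)) R := by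
  simp_rw [pulse_eq_indicator hn]
  exact exists_isPairing hX hf hf0 hE (measurable_const.indicator measurableSet_Ico)
    (abs_schwartzPulse_le _ _) (schwartzPulse_eq_zero _ _)
    (tendsto_lintegral_schwartzPulse_sub _ _)

theorem tendsto_integral_comp_smoothPulse (hf : Continuous f) (hf0 : f 0 = 0) {a b : ℝ}
    (hab : a ≤ b) (u : ℝ) :
    Tendsto (fun k => ∫ t, f (u * smoothPulse a b k t)) atTop (𝓝 ((b - a : ℝ) * f u)) := by
  obtain ⟨M, hM⟩ := (isCompact_Icc (a := -|u|) (b := |u|)).exists_bound_of_continuousOn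
    hf.continuousOn
  have h := tendsto_integral_of_dominated_convergence (μ := volume)
    (F := fun k t => f (u * smoothPulse a b k t))
    (f := (Set.Ioo a b).indicator fun _ => f u) ((Set.Icc a b).indicator fun _ => M)
    (fun k => (hf.comp (continuous_const.mul (continuous_smoothPulse a b k))).aestronglyMeasurable)
    ?_ ?_ ?_
  · rw [integral_indicator_const _ measurableSet_Ioo, Measure.real, Real.volume_Ioo,
      ENNReal.toReal_ofReal (by linarith)] at h
    simpa using h
  · exact (integrable_indicator_iff measurableSet_Icc).2 (by simp)
  · refine fun k => ae_of_all _ fun t => ?_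
    by_cases ht : t ∈ Set.Icc a b
    · rw [Set.indicator_of_mem ht]
      refine hM _ (abs_le.1 ?_)
      rw [abs_mul, abs_of_nonneg (smoothPulse_nonneg a b k t)]
      exact mul_le_of_le_one_right (abs_nonneg _) (smoothPulse_le_one a b k t)
    · rw [Set.indicator_of_notMem ht, smoothPulse_eq_zero k fun h' =>
        ht (Set.Ioo_subset_Icc_self h')]
      simp [hf0]
  · refine ae_of_all _ fun t => ?_
    have h1 := (hf.tendsto _).comp ((tendsto_smoothPulse a b t).const_mul u)
    have h2 : (Set.Ioo a b).indicator (fun _ => f u) t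
        = f (u * (Set.Ioo a b).indicator (fun _ => (1 : ℝ)) t) := by
      by_cases ht : t ∈ Set.Ioo a b <;> simp [ht, hf0]
    rw [h2]
    exact h1

/-- The approximating pulses have disjoint supports and f(0) = 0, so f of the sum is the sum of the
f's, and each interval contributes its length 1/n. One index gives the law of a sample; a finite
family gives independence. -/
theorem integral_exp_sum_isPairing (hX : Measurable X) (hf : Continuous f) (hf0 : f 0 = 0)
    (hE : ∀ φ : 𝓢(ℝ, ℝ), HasCompactSupport φ →
      ∫ ω, Complex.exp (Complex.I * ((X ω φ : ℝ) : ℂ)) ∂P = Complex.exp (∫ t : ℝ, f (φ t)))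
    {n : ℕ} (hn : 1 ≤ n) {κ : Type*} [Fintype κ] {e : κ → ℤ} (he : Function.Injective e)
    {R : κ → Ω → ℝ} (hR : ∀ j, IsPairing P X (fun t => pulse (n * t - e j + 1)) (R j))
    (u : κ → ℝ) :
    ∫ ω, Complex.exp (Complex.I * ((∑ j, u j * R j ω : ℝ) : ℂ)) ∂P
      = ∏ j, Complex.exp (f (u j) / n) := by
  have hn0 : (0 : ℝ) < n := by exact_mod_cast hn
  set φ : κ → ℕ → 𝓢(ℝ, ℝ) := fun j k => schwartzPulse (((e j : ℝ) - 1) / n) (e j / n) k with hφ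
  set ψ : ℕ → 𝓢(ℝ, ℝ) := fun k => ∑ j, u j • φ j k with hψ
  have hψX : ∀ k ω, X ω (ψ k) = ∑ j, u j * X ω (φ j k) := by
    intro k ω
    simp only [hψ, map_sum, map_smul, smul_eq_mul]
  have hψt : ∀ k t, ψ k t = ∑ j, u j * φ j k t := by
    intro k t
    simp only [hψ, sum_apply, smul_apply, smul_eq_mul]
  have hcs : ∀ k, HasCompactSupport (ψ k) := by
    intro k
    refine HasCompactSupport.intro (isCompact_Icc (a := -∑ j, max |((e j : ℝ) - 1) / n| |e j / n|)
      (b := ∑ j, max |((e j : ℝ) - 1) / n| |e j / n|)) fun t ht => ?_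
    rw [hψt]
    refine Finset.sum_eq_zero fun j _ => ?_
    rw [hφ, schwartzPulse_eq_zero, mul_zero]
    by_contra! h
    refine ht (abs_le.1 (h.trans ?_))
    exact Finset.single_le_sum (f := fun j => max |((e j : ℝ) - 1) / n| |e j / n|)
      (fun j _ => (abs_nonneg _).trans (le_max_left _ _)) (Finset.mem_univ j)
  have hconv : TendstoInMeasure P (fun k ω => X ω (ψ k)) atTop (fun ω => ∑ j, u j * R j ω) := by
    simp_rw [hψX]
    refine tendstoInMeasure_sum_real (U := fun j k ω => u j * X ω (φ j k)) (fun j => ?_) _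
    refine tendstoInMeasure_const_mul_real ((hR j).2 (φ j) ⟨1, abs_schwartzPulse_le _ _⟩
      ⟨_, schwartzPulse_eq_zero _ _⟩ ?_) _
    simp_rw [pulse_eq_indicator hn]
    exact tendsto_lintegral_schwartzPulse_sub _ _
  have h1 := tendsto_integral_exp_of_tendstoInMeasure (fun k => measurable_pairing hX (ψ k)) hconv
  simp_rw [fun k => hE (ψ k) (hcs k)] at h1
  have hdisj : ∀ k t, f (ψ k t) = ∑ j, f (u j * φ j k t) := by
    intro k t
    rw [hψt]
    by_cases hex : ∃ j, φ j k t ≠ 0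
    · obtain ⟨j, hj⟩ := hex
      -- Overlap of two open intervals would put their integer indices at distance less than 1.
      have hother : ∀ i, i ≠ j → φ i k t = 0 := by
        intro i hij
        by_contra hi
        have hmem : ∀ j, φ j k t ≠ 0 → t ∈ Set.Ioo (((e j : ℝ) - 1) / n) (e j / n) := by
          intro j hj
          by_contra hn'
          exact hj (smoothPulse_eq_zero k hn')
        have h2 := hmem j hj
        have h3 := hmem i hi
        rw [Set.mem_Ioo, div_lt_iff₀ hn0, lt_div_iff₀ hn0] at h2 h3
        have h4 : ((e i : ℝ) - 1) < e j := by linarith [h2.2, h3.1]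
        have h5 : ((e j : ℝ) - 1) < e i := by linarith [h3.2, h2.1]
        have h4' : e i - 1 < e j := by exact_mod_cast h4
        have h5' : e j - 1 < e i := by exact_mod_cast h5
        exact hij (he (by omega))
      rw [Finset.sum_eq_single j (fun i _ hij => by rw [hother i hij, mul_zero]) (by simp),
        Finset.sum_eq_single j (fun i _ hij => by rw [hother i hij, mul_zero, hf0]) (by simp)]
    · push Not at hex
      simp [hex, hf0]
  have hint : ∀ k j, Integrable fun t => f (u j * φ j k t) := by
    intro k j
    refine (hf.comp (continuous_const.mul (φ j k).continuous)).integrable_of_hasCompactSupport ?_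
    refine HasCompactSupport.comp_left (g := fun w => f (u j * w)) ?_ (by simpa using hf0)
    exact hasCompactSupport_smoothPulse _ _ k
  have h2 : Tendsto (fun k => Complex.exp (∫ t, f (ψ k t))) atTop
      (𝓝 (Complex.exp (∑ j, f (u j) / n))) := by
    refine (Complex.continuous_exp.tendsto _).comp ?_
    simp_rw [hdisj]
    simp_rw [fun k => integral_finsetSum (f := fun j t => f (u j * φ j k t)) Finset.univ
      fun j _ => hint k j]
    refine tendsto_finsetSum _ fun j _ => ?_
    have h3 := tendsto_integral_comp_smoothPulse hf hf0 (a := ((e j : ℝ) - 1) / n) (b := e j / n)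
      (by gcongr; linarith) (u j)
    have h4 : (((e j : ℝ) / n - ((e j : ℝ) - 1) / n : ℝ) : ℂ) * f (u j) = f (u j) / n := by
      rw [← sub_div, sub_sub_cancel]
      push_cast
      ring
    rw [h4] at h3
    exact h3
  rw [tendsto_nhds_unique h1 h2, Complex.exp_sum]

theorem charFun_isPairing (hX : Measurable X) (hf : Continuous f) (hf0 : f 0 = 0)
    (hE : ∀ φ : 𝓢(ℝ, ℝ), HasCompactSupport φ →
      ∫ ω, Complex.exp (Complex.I * ((X ω φ : ℝ) : ℂ)) ∂P = Complex.exp (∫ t : ℝ, f (φ t)))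
    {n : ℕ} (hn : 1 ≤ n) {i : ℤ} {R : Ω → ℝ}
    (hR : IsPairing P X (fun t => pulse (n * t - i + 1)) R) (u : ℝ) :
    charFun (P.map R) u = Complex.exp (f u / n) := by
  have h := integral_exp_sum_isPairing hX hf hf0 hE hn (κ := Unit) (e := fun _ => i)
    (fun _ _ _ => rfl) (R := fun _ => R) (fun _ => hR) (fun _ => u)
  simp only [Finset.univ_unique, Finset.sum_singleton, Finset.prod_singleton] at h
  rw [← h, charFun_apply_real, integral_map hR.1.aemeasurable (by fun_prop)]
  refine integral_congr_ae (ae_of_all _ fun ω => ?_)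
  simp only [Complex.ofReal_mul]
  ring_nf

/-- On every finite set of indices the joint characteristic function factors, which characterizes
independence. -/
theorem iIndepFun_isTimeQuantization (hX : Measurable X) (hf : Continuous f) (hf0 : f 0 = 0)
    (hE : ∀ φ : 𝓢(ℝ, ℝ), HasCompactSupport φ →
      ∫ ω, Complex.exp (Complex.I * ((X ω φ : ℝ) : ℂ)) ∂P = Complex.exp (∫ t : ℝ, f (φ t)))
    {n : ℕ} (hn : 1 ≤ n) {R : ℤ → Ω → ℝ} (hR : IsTimeQuantization P X n R) :
    iIndepFun R P := by
  rw [iIndepFun_iff_finset]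
  intro s
  have hRm : ∀ i, Measurable (R i) := fun i => (hR i).1
  change iIndepFun (fun i : s => R i) P
  refine (iIndepFun_iff_charFun_pi (X := fun i : s => R i)
    fun i => (hRm i).aemeasurable).2 fun t => ?_
  have h := integral_exp_sum_isPairing hX hf hf0 hE hn (κ := s) (e := fun i => (i : ℤ))
    Subtype.val_injective (R := fun i => R i) (fun i => hR i) (fun i => t i)
  simp_rw [fun i : s => charFun_isPairing hX hf hf0 hE hn (hR i)]
  rw [← h, charFun_apply, integral_map (by fun_prop) (by fun_prop)]
  refine integral_congr_ae (ae_of_all _ fun ω => ?_)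
  simp only [PiLp.inner_apply, RCLike.inner_apply, conj_trivial]
  rw [mul_comm]

theorem map_isTimeQuantization_eq (hX : Measurable X) (hf : Continuous f) (hf0 : f 0 = 0)
    (hE : ∀ φ : 𝓢(ℝ, ℝ), HasCompactSupport φ →
      ∫ ω, Complex.exp (Complex.I * ((X ω φ : ℝ) : ℂ)) ∂P = Complex.exp (∫ t : ℝ, f (φ t)))
    {n : ℕ} (hn : 1 ≤ n) {R : ℤ → Ω → ℝ} (hR : IsTimeQuantization P X n R) (i j : ℤ) :
    P.map (R i) = P.map (R j) := by
  have hp : ∀ i, IsProbabilityMeasure (P.map (R i)) := fun i =>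
    Measure.isProbabilityMeasure_map (hR i).1.aemeasurable
  refine Measure.ext_of_charFun (funext fun u => ?_)
  rw [charFun_isPairing hX hf hf0 hE hn (hR i), charFun_isPairing hX hf hf0 hE hn (hR j)]

end WhiteNoise

/-! ### The exponent of a stable law -/

/-- The odd part `|w|^α sgn(w) Φ(w)` of a stable exponent. -/
noncomputable def stableSkew (α w : ℝ) : ℝ := |w| ^ α * (Real.sign w * stablePhi α w)

theorem stableExponent_eq (α β σ μ w : ℝ) :
    stableExponent α β σ μ w = ((-(σ ^ α * |w| ^ α) : ℝ) : ℂ)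
      + Complex.I * ((w * μ + σ ^ α * β * stableSkew α w : ℝ) : ℂ) := by
  rw [stableExponent, stableSkew]
  push_cast
  ring

theorem stableExponent_re (α β σ μ w : ℝ) :
    (stableExponent α β σ μ w).re = -(σ ^ α * |w| ^ α) := by
  rw [stableExponent_eq]
  simp only [Complex.add_re, Complex.ofReal_re, Complex.mul_re, Complex.I_re, Complex.I_im,
    Complex.ofReal_im]
  ring

theorem abs_mul_realSign (w : ℝ) : |w| * Real.sign w = w := by
  rcases lt_trichotomy w 0 with h | rfl | h
  · rw [abs_of_neg h, Real.sign_of_neg h]; ring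
  · simp
  · rw [abs_of_pos h, Real.sign_of_pos h]; ring

theorem sign_mul_of_pos {c : ℝ} (hc : 0 < c) (w : ℝ) : Real.sign (c * w) = Real.sign w := by
  rcases lt_trichotomy w 0 with h | rfl | h
  · rw [Real.sign_of_neg h, Real.sign_of_neg (mul_neg_of_pos_of_neg hc h)]
  · simp
  · rw [Real.sign_of_pos h, Real.sign_of_pos (mul_pos hc h)]

theorem abs_sign_le_one (w : ℝ) : |Real.sign w| ≤ 1 := by
  rcases Real.sign_apply_eq w with h | h | h <;> simp [h]

theorem stableSkew_one (w : ℝ) : stableSkew 1 w = -(2 / Real.pi) * (w * Real.log w) := by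
  rw [stableSkew, stablePhi, if_pos rfl, Real.rpow_one, ← mul_assoc, abs_mul_realSign, Real.log_abs]
  ring

/-- For α = 1 the logarithm is tamed by the factor w. Otherwise the odd power is the difference of
the powers of the positive and negative parts, which removes the jump of the sign. -/
theorem continuous_stableSkew {α : ℝ} (hα : 0 < α) : Continuous (stableSkew α) := by
  rcases eq_or_ne α 1 with rfl | h1
  · simp_rw [funext stableSkew_one]
    exact continuous_const.mul Real.continuous_mul_log
  · have h : stableSkew α = fun w => ((max w 0) ^ α - (max (-w) 0) ^ α)
        * Real.tan (Real.pi * α / 2) := by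
      funext w
      rw [stableSkew, stablePhi, if_neg h1, ← mul_assoc]
      congr 1
      rcases lt_trichotomy w 0 with h | rfl | h
      · rw [abs_of_neg h, Real.sign_of_neg h, max_eq_right h.le, max_eq_left (by linarith),
          Real.zero_rpow hα.ne']
        ring
      · simp [Real.zero_rpow hα.ne']
      · rw [abs_of_pos h, Real.sign_of_pos h, max_eq_left h.le, max_eq_right (by linarith),
          Real.zero_rpow hα.ne']
        ring
    rw [h]
    exact (((continuous_id.max continuous_const).rpow_const fun _ => Or.inr hα.le).sub
      ((continuous_neg.max continuous_const).rpow_const fun _ => Or.inr hα.le)).mul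
      continuous_const

theorem continuous_stableExponent {α : ℝ} (hα : 0 < α) (β σ μ : ℝ) :
    Continuous (stableExponent α β σ μ) := by
  rw [funext (stableExponent_eq α β σ μ)]
  have h1 := continuous_stableSkew hα
  have h2 : Continuous fun w : ℝ => |w| ^ α := continuous_abs.rpow_const fun _ => Or.inr hα.le
  fun_prop

theorem stableExponent_zero {α : ℝ} (hα : 0 < α) (β σ μ : ℝ) : stableExponent α β σ μ 0 = 0 := by
  rw [stableExponent]
  simp [Real.zero_rpow hα.ne']

/-- The restriction s ≤ 1/2 serves the case α = 1, where |w|^(1/2) |log |w|| ≤ 2 and the other half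
power of |w| is at most |w|^s. -/
theorem exists_abs_stableSkew_le {α s : ℝ} (hs : s ≤ 1 / 2) (hs0 : 0 < s) (hsα : s ≤ α) :
    ∃ C : ℝ, ∀ w, |w| ≤ 1 → |stableSkew α w| ≤ C * |w| ^ s := by
  rcases eq_or_ne α 1 with rfl | h1
  · refine ⟨2 / Real.pi * 2, fun w hw => ?_⟩
    rcases eq_or_ne w 0 with rfl | h0
    · rw [stableSkew_one]
      simp [Real.zero_rpow hs0.ne']
    · have hw0 : 0 < |w| := abs_pos.2 h0
      have h2 := (Real.abs_log_mul_self_rpow_lt |w| (1 / 2) hw0 hw (by norm_num)).le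
      have h3 : |w| ^ (1 / 2 : ℝ) ≤ |w| ^ s := Real.rpow_le_rpow_of_exponent_ge hw0 hw hs
      have h4 : |w| = |w| ^ (1 / 2 : ℝ) * |w| ^ (1 / 2 : ℝ) := by
        rw [← Real.rpow_add hw0]; norm_num
      have hL : |(Real.log |w|)| * |w| ^ (1 / 2 : ℝ) ≤ 2 := by
        rw [abs_mul, abs_of_pos (Real.rpow_pos_of_pos hw0 _)] at h2
        linarith
      have h5 : |w * Real.log w| ≤ 2 * |w| ^ s := by
        rw [abs_mul, ← Real.log_abs]
        calc |w| * |(Real.log |w|)|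
            = |w| ^ (1 / 2 : ℝ) * (|(Real.log |w|)| * |w| ^ (1 / 2 : ℝ)) := by
              rw [mul_comm |(Real.log |w|)|, ← mul_assoc, ← h4]
          _ ≤ |w| ^ s * 2 := by gcongr
          _ = _ := mul_comm _ _
      rw [stableSkew_one, abs_mul, abs_neg, abs_of_pos (by positivity : 0 < 2 / Real.pi), mul_assoc]
      gcongr
  · refine ⟨|Real.tan (Real.pi * α / 2)|, fun w hw => ?_⟩
    rcases eq_or_ne w 0 with rfl | h0
    · simp [stableSkew, Real.zero_rpow hs0.ne']
    have hw0 : 0 < |w| := abs_pos.2 h0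
    rw [stableSkew, stablePhi, if_neg h1, abs_mul, abs_mul, abs_of_pos (Real.rpow_pos_of_pos hw0 _)]
    have h2 : |w| ^ α ≤ |w| ^ s := Real.rpow_le_rpow_of_exponent_ge hw0 hw hsα
    calc |w| ^ α * (|Real.sign w| * |Real.tan (Real.pi * α / 2)|)
        ≤ |w| ^ s * (1 * |Real.tan (Real.pi * α / 2)|) := by
          gcongr
          exact abs_sign_le_one w
      _ = _ := by ring

theorem exists_norm_stableExponent_le {α s : ℝ} (hs : s ≤ 1 / 2) (hs0 : 0 < s) (hsα : s ≤ α)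
    (β σ μ : ℝ) :
    ∃ C : ℝ, 0 ≤ C ∧ ∀ w, |w| ≤ 1 → ‖stableExponent α β σ μ w‖ ≤ C * |w| ^ s := by
  obtain ⟨C, hC⟩ := exists_abs_stableSkew_le hs hs0 hsα
  refine ⟨|σ ^ α| + |μ| + |σ ^ α * β| * |C|, by positivity, fun w hw => ?_⟩
  rcases eq_or_ne w 0 with rfl | h0
  · rw [stableExponent_zero (hs0.trans_le hsα)]
    simp [Real.zero_rpow hs0.ne']
  have hw0 : 0 < |w| := abs_pos.2 h0
  have h2 : |w| ^ α ≤ |w| ^ s := Real.rpow_le_rpow_of_exponent_ge hw0 hw hsα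
  have h3 : |w| ≤ |w| ^ s := by
    conv_lhs => rw [← Real.rpow_one |w|]
    exact Real.rpow_le_rpow_of_exponent_ge hw0 hw (by linarith)
  have h4 : |stableSkew α w| ≤ |C| * |w| ^ s :=
    (hC w hw).trans (by gcongr; exact le_abs_self C)
  rw [stableExponent_eq]
  refine (norm_add_le _ _).trans ?_
  rw [norm_mul, Complex.norm_I, one_mul, Complex.norm_real, Complex.norm_real, Real.norm_eq_abs,
    Real.norm_eq_abs, abs_neg, abs_mul, abs_of_pos (Real.rpow_pos_of_pos hw0 _)]
  have h5 := abs_add_le (w * μ) (σ ^ α * β * stableSkew α w)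
  rw [abs_mul w, abs_mul _ (stableSkew α w)] at h5
  have h6 : |σ ^ α| * |w| ^ α ≤ |σ ^ α| * |w| ^ s := by gcongr
  have h7 : |w| * |μ| ≤ |w| ^ s * |μ| := by gcongr
  have h8 : |σ ^ α * β| * |stableSkew α w| ≤ |σ ^ α * β| * (|C| * |w| ^ s) := by gcongr
  linarith

/-- For α ≠ 1 the skew is homogeneous and d = 0. For α = 1 the term log c in log (c w) leaves a
drift linear in w. -/
theorem exists_stableSkew_mul {α : ℝ} {c : ℝ} (hc : 0 < c) :
    ∃ d : ℝ, ∀ w, stableSkew α (c * w) = c ^ α * (stableSkew α w + d * w) := by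
  rcases eq_or_ne α 1 with rfl | h1
  · refine ⟨-(2 / Real.pi) * Real.log c, fun w => ?_⟩
    rcases eq_or_ne w 0 with rfl | h0
    · simp [stableSkew]
    · rw [stableSkew_one, stableSkew_one, Real.log_mul hc.ne' h0, Real.rpow_one]
      ring
  · refine ⟨0, fun w => ?_⟩
    rw [stableSkew, stableSkew, stablePhi, stablePhi, if_neg h1, if_neg h1, abs_mul, abs_of_pos hc,
      Real.mul_rpow hc.le (abs_nonneg w), sign_mul_of_pos hc]
    ring

/-- The factor n^(1/α) has α-th power n, which cancels the division by n. What is left over is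
linear in w and imaginary, hence a deterministic shift of the variable. -/
theorem exists_stableExponent_scaling {α : ℝ} (hα : 0 < α) (β σ μ : ℝ) {n : ℕ} (hn : 1 ≤ n) :
    ∃ d : ℝ, ∀ w, stableExponent α β σ μ ((n : ℝ) ^ (1 / α) * w) / n
      = stableExponent α β σ μ w + Complex.I * ((d * w : ℝ) : ℂ) := by
  have hn0 : (0 : ℝ) < n := by exact_mod_cast hn
  have hnC : (n : ℂ) ≠ 0 := by exact_mod_cast hn0.ne'
  set c : ℝ := (n : ℝ) ^ (1 / α) with hc
  have hc0 : 0 < c := Real.rpow_pos_of_pos hn0 _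
  have hcα : c ^ α = n := by
    rw [hc, ← Real.rpow_mul hn0.le, one_div_mul_cancel hα.ne', Real.rpow_one]
  obtain ⟨d, hd⟩ := exists_stableSkew_mul (α := α) hc0
  refine ⟨μ * (c / n - 1) + σ ^ α * β * d, fun w => ?_⟩
  rw [stableExponent_eq, stableExponent_eq, hd, abs_mul, abs_of_pos hc0,
    Real.mul_rpow hc0.le (abs_nonneg w), hcα]
  push_cast
  field_simp
  ring

/-! ### The exponent of a compound Poisson law -/

theorem norm_exp_I_mul_sub_one_le_two (x : ℝ) : ‖Complex.exp (Complex.I * x) - 1‖ ≤ 2 := by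
  refine (norm_sub_le _ _).trans ?_
  rw [mul_comm, Complex.norm_exp_ofReal_mul_I, norm_one]
  norm_num

theorem norm_exp_I_mul_sub_one_le_rpow {s : ℝ} (hs : 0 < s) (hs1 : s ≤ 1) (x : ℝ) :
    ‖Complex.exp (Complex.I * x) - 1‖ ≤ 2 * |x| ^ s := by
  rcases le_or_gt |x| 1 with h | h
  · refine Real.norm_exp_I_mul_ofReal_sub_one_le.trans ?_
    rcases eq_or_ne x 0 with rfl | h0
    · simp [Real.zero_rpow hs.ne']
    have hx0 : 0 < |x| := abs_pos.2 h0
    have h3 : |x| ≤ |x| ^ s := by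
      conv_lhs => rw [← Real.rpow_one |x|]
      exact Real.rpow_le_rpow_of_exponent_ge hx0 h hs1
    rw [Real.norm_eq_abs]
    linarith
  · refine (norm_exp_I_mul_sub_one_le_two x).trans ?_
    have := Real.one_le_rpow h.le hs.le
    linarith

section Poisson

variable {r : ℝ} {ν : Measure ℝ} [IsProbabilityMeasure ν]

theorem poissonExponent_integrand_eq (a w : ℝ) :
    Complex.exp (Complex.I * (a : ℂ) * (w : ℂ)) - 1
      = Complex.exp (Complex.I * ((a * w : ℝ) : ℂ)) - 1 := by
  push_cast
  rw [mul_assoc]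

theorem integrable_poissonExponent_integrand (w : ℝ) :
    IntegrableOn (fun a : ℝ => Complex.exp (Complex.I * (a : ℂ) * (w : ℂ)) - 1) {0}ᶜ ν := by
  refine Integrable.mono' (integrable_const (2 : ℝ)) (by fun_prop) (ae_of_all _ fun a => ?_)
  rw [poissonExponent_integrand_eq]
  exact norm_exp_I_mul_sub_one_le_two _

theorem continuous_poissonExponent (r : ℝ) (ν : Measure ℝ) [IsProbabilityMeasure ν] :
    Continuous (poissonExponent r ν) := by
  refine continuous_const.mul (continuous_of_dominated (bound := fun _ => 2)
    (fun w => (integrable_poissonExponent_integrand w).aestronglyMeasurable)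
    (fun w => ae_of_all _ fun a => ?_) (integrable_const _) (ae_of_all _ fun a => by fun_prop))
  rw [poissonExponent_integrand_eq]
  exact norm_exp_I_mul_sub_one_le_two _

theorem poissonExponent_zero (r : ℝ) (ν : Measure ℝ) : poissonExponent r ν 0 = 0 := by
  simp [poissonExponent]

theorem norm_poissonExponent_le (hr : 0 ≤ r) (w : ℝ) : ‖poissonExponent r ν w‖ ≤ 2 * r := by
  rw [poissonExponent, norm_mul, Complex.norm_real, Real.norm_of_nonneg hr]
  have h : ‖∫ a in ({0}ᶜ : Set ℝ), (Complex.exp (Complex.I * (a : ℂ) * (w : ℂ)) - 1) ∂ν‖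
      ≤ 2 * ν.real {0}ᶜ := by
    refine norm_setIntegral_le_of_norm_le_const (measure_lt_top _ _) fun a _ => ?_
    rw [poissonExponent_integrand_eq]
    exact norm_exp_I_mul_sub_one_le_two _
  have h1 : ν.real ({0}ᶜ : Set ℝ) ≤ 1 := measureReal_le_one
  nlinarith

theorem poissonExponent_re_nonpos (hr : 0 ≤ r) (w : ℝ) : (poissonExponent r ν w).re ≤ 0 := by
  rw [poissonExponent, Complex.re_ofReal_mul]
  refine mul_nonpos_of_nonneg_of_nonpos hr ?_
  rw [← RCLike.re_eq_complex_re, ← integral_re (integrable_poissonExponent_integrand w)]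
  refine integral_nonpos fun a => ?_
  rw [poissonExponent_integrand_eq, RCLike.re_eq_complex_re, Complex.sub_re, Complex.one_re,
    mul_comm, Complex.exp_ofReal_mul_I_re]
  exact sub_nonpos.2 (Real.cos_le_one _)

/-- The elementary bound |e^(iaw) - 1| ≤ 2 |a|^s |w|^s is integrated in a. It trades the low-order
moment of the amplitude for Hölder decay of the exponent at 0. -/
theorem exists_norm_poissonExponent_le_rpow (hr : 0 ≤ r) {s θ : ℝ} (hs : 0 < s) (hs1 : s ≤ 1)
    (hsθ : s ≤ θ) (hν : Integrable (fun a : ℝ => |a| ^ θ) ν) :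
    ∃ C : ℝ, 0 ≤ C ∧ ∀ w, ‖poissonExponent r ν w‖ ≤ C * |w| ^ s := by
  -- The lower power is integrable because |a|^s ≤ 1 + |a|^θ.
  have hint : Integrable (fun a : ℝ => |a| ^ s) ν := by
    refine Integrable.mono' ((integrable_const (1 : ℝ)).add hν) ?_ (ae_of_all _ fun a => ?_)
    · exact (continuous_abs.rpow_const fun _ => Or.inr hs.le).aestronglyMeasurable
    · have h0 : 0 ≤ |a| ^ s := by positivity
      have h1 : 0 ≤ |a| ^ θ := by positivity
      rw [Real.norm_of_nonneg h0, Pi.add_apply]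
      rcases le_or_gt |a| 1 with h | h
      · have := Real.rpow_le_one (abs_nonneg a) h hs.le
        linarith
      · have := Real.rpow_le_rpow_of_exponent_le h.le hsθ
        linarith
  have hnn : 0 ≤ ∫ a, |a| ^ s ∂ν := integral_nonneg fun a => by positivity
  refine ⟨r * (2 * ∫ a, |a| ^ s ∂ν), by positivity, fun w => ?_⟩
  rw [poissonExponent, norm_mul, Complex.norm_real, Real.norm_of_nonneg hr, mul_assoc]
  gcongr
  calc ‖∫ a in ({0}ᶜ : Set ℝ), (Complex.exp (Complex.I * (a : ℂ) * (w : ℂ)) - 1) ∂ν‖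
      ≤ ∫ a in ({0}ᶜ : Set ℝ), 2 * |w| ^ s * |a| ^ s ∂ν := by
        refine norm_integral_le_of_norm_le (hint.const_mul _).integrableOn
          (ae_of_all _ fun a => ?_)
        rw [poissonExponent_integrand_eq]
        refine (norm_exp_I_mul_sub_one_le_rpow hs hs1 _).trans_eq ?_
        rw [abs_mul, Real.mul_rpow (abs_nonneg _) (abs_nonneg _)]
        ring
    _ ≤ ∫ a, 2 * |w| ^ s * |a| ^ s ∂ν :=
        setIntegral_le_integral (hint.const_mul _) (ae_of_all _ fun a => by positivity)
    _ = _ := by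
        rw [integral_const_mul]
        ring

end Poisson

/-! ### Exponentials of exponents -/

theorem norm_exp_sub_one_le_of_re_nonpos {z : ℂ} (hz : z.re ≤ 0) :
    ‖Complex.exp z - 1‖ ≤ 2 * ‖z‖ := by
  rcases le_or_gt ‖z‖ 1 with h | h
  · exact Complex.norm_exp_sub_one_le h
  · refine (norm_sub_le _ _).trans ?_
    rw [Complex.norm_exp, norm_one]
    have := Real.exp_le_one_iff.2 hz
    linarith

/-! ### Entropy of fine quantizations under convergence of characteristic functions -/

theorem inversionDensity_le {φ : ℝ → ℂ} (hφ : Integrable φ) (x : ℝ) :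
    inversionDensity φ x ≤ ∫ t, ‖φ t‖ := by
  have h := abs_inversionDensity_sub_le (χ := fun _ => 0) hφ (integrable_zero ℝ ℂ volume) x
  have h0 : inversionDensity (fun _ => 0) x = 0 := by
    simp [inversionDensity, Real.fourier_eq]
  simp only [h0, sub_zero] at h
  exact (le_abs_self _).trans h

theorem lintegral_inversionDensity_mul_rpow (μ : Measure ℝ) [IsProbabilityMeasure μ]
    (hφ : Integrable (charFun μ)) {s : ℝ} :
    ∫⁻ x, ENNReal.ofReal (inversionDensity (charFun μ) x * |x| ^ s)
      = ∫⁻ x, ENNReal.ofReal (|x| ^ s) ∂μ := by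
  conv_rhs => rw [eq_withDensity_inversionDensity μ hφ]
  have hm := (continuous_inversionDensity hφ).measurable
  rw [lintegral_withDensity_eq_lintegral_mul _ (by fun_prop) (by fun_prop)]
  refine lintegral_congr fun x => ?_
  rw [Pi.mul_apply, ENNReal.ofReal_mul (inversionDensity_nonneg μ hφ x)]

theorem integrable_charFun_of_le {μ : Measure ℝ} [IsFiniteMeasure μ] {G : ℝ → ℝ}
    (hG : Integrable G) (h : ∀ t, ‖charFun μ t‖ ≤ G t) : Integrable (charFun μ) :=
  hG.mono' (by fun_prop) (ae_of_all _ h)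

/-- The envelope `G` bounds all densities uniformly, the moments of order s control the tails, and
the L¹ convergence makes the densities uniformly close to a continuous limit. The bins shrink, so
the bin averages converge pointwise for any choice of offsets `u`. -/
theorem tendsto_integral_negMulLog_binDensity {ι : Type*} {l : Filter ι} [l.IsCountablyGenerated]
    {μ : ι → Measure ℝ} {μ₀ : Measure ℝ} [IsProbabilityMeasure μ₀] {G : ℝ → ℝ} {s : ℝ} {K : ℝ≥0∞}
    {u m : ι → ℝ} (hG : Integrable G) (hs : 0 < s) (hs1 : s ≤ 1) (hK : K ≠ ∞)
    (hμ : ∀ᶠ i in l, IsProbabilityMeasure (μ i))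
    (hφ : ∀ᶠ i in l, ∀ t, ‖charFun (μ i) t‖ ≤ G t) (hφ₀ : ∀ t, ‖charFun μ₀ t‖ ≤ G t)
    (hlim : Tendsto (fun i => ∫ t, ‖charFun (μ i) t - charFun μ₀ t‖) l (𝓝 0))
    (hw : ∀ᶠ i in l, ∫⁻ x, ENNReal.ofReal (|x| ^ s) ∂(μ i) ≤ K)
    (hw₀ : ∫⁻ x, ENNReal.ofReal (|x| ^ s) ∂μ₀ ≤ K) (hm : Tendsto m l atTop) :
    Tendsto (fun i => ∫ x, Real.negMulLog (binDensity (μ i) (u i) (m i) x)) l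
      (𝓝 (∫ x, Real.negMulLog (inversionDensity (charFun μ₀) x))) := by
  have hi₀ := integrable_charFun_of_le hG hφ₀
  have hB : ∀ (μ : Measure ℝ) [IsProbabilityMeasure μ], (∀ t, ‖charFun μ t‖ ≤ G t) →
      ∀ x, inversionDensity (charFun μ) x ≤ ∫ t, G t := fun μ _ h x =>
    (inversionDensity_le (integrable_charFun_of_le hG h) x).trans
      (integral_mono (integrable_charFun_of_le hG h).norm hG h)
  have hG0 : 0 ≤ ∫ t, G t := integral_nonneg fun t => (norm_nonneg _).trans (hφ₀ t)
  have hc₀ := continuous_inversionDensity hi₀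
  refine tendsto_integral_negMulLog (B := ∫ t, G t) (K := K + 1) hs (by simp [hK])
    (fun i => measurable_binDensity _ _ _) hc₀.measurable ?_ ?_
    (inversionDensity_nonneg μ₀ hi₀) (hB μ₀ hφ₀) ?_ ?_ ?_
  · filter_upwards [hm.eventually_gt_atTop 0] with i hi x
    exact binDensity_nonneg _ hi _ _
  · filter_upwards [hm.eventually_gt_atTop 0, hμ, hφ] with i hi hp h x
    exact binDensity_le_of_density (eq_withDensity_inversionDensity (μ i)
      (integrable_charFun_of_le hG h)) hi hG0 fun y _ => hB (μ i) h y
  · filter_upwards [hm.eventually_ge_atTop 1, hμ, hw] with i hi hp h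
    have hi0 : 0 < m i := lt_of_lt_of_le one_pos hi
    refine (lintegral_binDensity_mul_rpow_le (μ i) hi0 hs hs1).trans ?_
    gcongr
    rw [← ENNReal.ofReal_one]
    refine ENNReal.ofReal_le_ofReal (Real.rpow_le_one (by positivity) ?_ hs.le)
    rw [div_le_one hi0]
    exact hi
  · rw [lintegral_inversionDensity_mul_rpow μ₀ hi₀]
    exact hw₀.trans le_self_add
  · intro x
    rw [Metric.tendsto_nhds]
    intro ε hε
    obtain ⟨δ, hδ, hcont⟩ := Metric.continuousAt_iff.1 (hc₀.continuousAt (x := x)) (ε / 4)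
      (by positivity)
    filter_upwards [hm.eventually_gt_atTop 0, hm.eventually_gt_atTop (1 / δ), hμ, hφ,
      hlim.eventually_lt_const (show (0 : ℝ) < ε / 4 by positivity)] with i hi hiδ hp h hl
    have hqi := integrable_charFun_of_le hG h
    have hclose : ∀ y ∈ quantBin (u i) (m i) x,
        |inversionDensity (charFun (μ i)) y - inversionDensity (charFun μ₀) x| ≤ ε / 2 := by
      intro y hy
      have h1 := abs_inversionDensity_sub_le hqi hi₀ y
      have h2 : |y - x| < δ := by
        refine (abs_sub_le_of_mem_quantBin hi hy).trans_lt ?_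
        rwa [div_lt_comm₀ hi hδ]
      have h3 := hcont (x := y) (by rwa [Real.dist_eq])
      rw [Real.dist_eq] at h3
      have h4 := abs_sub_le (inversionDensity (charFun (μ i)) y) (inversionDensity (charFun μ₀) y)
        (inversionDensity (charFun μ₀) x)
      linarith
    have hd := eq_withDensity_inversionDensity (μ i) hqi
    have hp0 := inversionDensity_nonneg μ₀ hi₀ x
    have hup := binDensity_le_of_density (U := inversionDensity (charFun μ₀) x + ε / 2) hd hi
      (by positivity) fun y hy => by linarith [(abs_le.1 (hclose y hy)).2]
    have hlo := le_binDensity_of_density (b := inversionDensity (charFun μ₀) x - ε / 2) hd hi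
      (continuous_inversionDensity hqi).measurable
      fun y hy => by linarith [(abs_le.1 (hclose y hy)).1]
    rw [Real.dist_eq, abs_lt]
    constructor <;> linarith

/-- Substituting W = c R - d turns 1/2 + m R into (1/2 + (m/c) d) + (m/c) W. The bins are the same
events, and the shift d survives only in the offset, where it is harmless. -/
theorem discreteEntropy_quantize_affine {Ω : Type*} [MeasurableSpace Ω] (P : Measure Ω)
    [IsProbabilityMeasure P] {R : Ω → ℝ} (hR : Measurable R) {c d m s : ℝ} (hc : 0 < c)
    (hm : 0 < m) (hs : 0 < s) (hs1 : s ≤ 1)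
    (hw : ∫⁻ x, ENNReal.ofReal (|x| ^ s) ∂(P.map fun ω => c * R ω - d) ≠ ∞) :
    discreteEntropy P (fun ω => quantize m (R ω)) ≠ ∞ ∧
    (discreteEntropy P (fun ω => quantize m (R ω))).toReal
      = (∫ x, Real.negMulLog (binDensity (P.map fun ω => c * R ω - d) (1 / 2 + m / c * d)
          (m / c) x)) + Real.log (m / c) := by
  have hWm : Measurable fun ω => c * R ω - d := by fun_prop
  have hp : IsProbabilityMeasure (P.map fun ω => c * R ω - d) :=
    Measure.isProbabilityMeasure_map hWm.aemeasurable
  have hmc : 0 < m / c := by positivity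
  have hmom := lintegral_binDensity_mul_rpow_le (P.map fun ω => c * R ω - d)
    (u := 1 / 2 + m / c * d) hmc hs hs1
  have hint := integrable_negMulLog_of_moment hs
    (measurable_binDensity (P.map fun ω => c * R ω - d) (1 / 2 + m / c * d) (m / c))
    (binDensity_nonneg _ hmc _) (binDensity_le _ hmc _)
    (ne_top_of_le_ne_top (ENNReal.add_ne_top.2 ⟨hw, ENNReal.ofReal_ne_top⟩) hmom)
  have hsum := hasSum_negMulLog_bins _ hmc hint
  have hbin : ∀ k : ℤ, (P.map fun ω => c * R ω - d).real
      {y : ℝ | ⌊1 / 2 + m / c * d + m / c * y⌋ = k} = P.real {ω | ⌊1 / 2 + m * R ω⌋ = k} := by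
    intro k
    rw [map_measureReal_apply hWm (measurableSet_floor_preimage _ _ _)]
    congr 1
    ext ω
    change ⌊1 / 2 + m / c * d + m / c * (c * R ω - d)⌋ = k ↔ ⌊1 / 2 + m * R ω⌋ = k
    rw [show 1 / 2 + m / c * d + m / c * (c * R ω - d) = 1 / 2 + m * R ω by field_simp; ring]
  simp_rw [hbin] at hsum
  have h0 : ∀ k : ℤ, 0 ≤ Real.negMulLog (P.real {ω | ⌊1 / 2 + m * R ω⌋ = k}) := fun k =>
    Real.negMulLog_nonneg measureReal_nonneg measureReal_le_one
  rw [discreteEntropy_quantize_eq P hm, ← ENNReal.ofReal_tsum_of_nonneg h0 hsum.summable]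
  refine ⟨ENNReal.ofReal_ne_top, ?_⟩
  rw [ENNReal.toReal_ofReal (tsum_nonneg h0), hsum.tsum_eq]

theorem hasDifferentialEntropy_of_charFun {Ω : Type*} [MeasurableSpace Ω] (P : Measure Ω)
    [IsProbabilityMeasure P] {W : Ω → ℝ} (hW : Measurable W) {s : ℝ} (hs : 0 < s)
    (hφ : Integrable (charFun (P.map W)))
    (hw : ∫⁻ x, ENNReal.ofReal (|x| ^ s) ∂(P.map W) ≠ ∞) :
    HasDifferentialEntropy P W ∧
    differentialEntropy P W
      = ∫ x, Real.negMulLog (inversionDensity (charFun (P.map W)) x) := by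
  have hp : IsProbabilityMeasure (P.map W) := Measure.isProbabilityMeasure_map hW.aemeasurable
  have hd := eq_withDensity_inversionDensity (P.map W) hφ
  have hc := continuous_inversionDensity hφ
  have hm : Measurable fun x => ENNReal.ofReal (inversionDensity (charFun (P.map W)) x) :=
    hc.measurable.ennreal_ofReal
  have hpdf : HasPDF W P volume := hasPDF_of_map_eq_withDensity hW.aemeasurable _ hm.aemeasurable hd
  -- The density `pdf` is a Radon–Nikodym derivative, so it agrees with the inversion formula only
  -- almost everywhere.
  have hae : entropyDensity P W =ᵐ[volume]
      fun x => Real.negMulLog (inversionDensity (charFun (P.map W)) x) := by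
    have h1 : pdf W P volume =ᵐ[volume]
        fun x => ENNReal.ofReal (inversionDensity (charFun (P.map W)) x) := by
      rw [pdf_def]
      conv_lhs => rw [hd]
      exact Measure.rnDeriv_withDensity _ hm
    filter_upwards [h1] with x hx
    rw [entropyDensity, hx, ENNReal.toReal_ofReal (inversionDensity_nonneg _ hφ x)]
  refine ⟨⟨hpdf, Integrable.congr ?_ hae.symm⟩, integral_congr_ae hae⟩
  refine integrable_negMulLog_of_moment hs hc.measurable (inversionDensity_nonneg _ hφ)
    (inversionDensity_le hφ) ?_
  rwa [lintegral_inversionDensity_mul_rpow _ hφ]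

/-! ### Sums of independent white noises -/

theorem measurable_add_distribution {Ω : Type*} [MeasurableSpace Ω]
    {X Y : Ω → RealTemperedDistribution} (hX : Measurable X) (hY : Measurable Y) :
    Measurable fun ω => X ω + Y ω := by
  rw [measurable_iff_comap_le, cylindricalMeasurableSpace, MeasurableSpace.comap_iSup]
  refine iSup_le fun φ => ?_
  rw [MeasurableSpace.comap_comp, ← measurable_iff_comap_le]
  exact (measurable_pairing hX φ).add (measurable_pairing hY φ)

/-- Independence multiplies the two functionals. Compact support of `φ` makes both integrands
integrable, so that the exponents can be added under one integral. -/
theorem exponent_add_of_indepFun {Ω : Type*} [MeasurableSpace Ω] {P : Measure Ω}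
    [IsProbabilityMeasure P] {X Y : Ω → RealTemperedDistribution} {f g : ℝ → ℂ}
    (hX : Measurable X) (hY : Measurable Y) (hXY : IndepFun X Y P) (hf : Continuous f)
    (hf0 : f 0 = 0) (hg : Continuous g) (hg0 : g 0 = 0) (hfX : HasWhiteNoiseExponent P X f)
    (hgY : HasWhiteNoiseExponent P Y g) (φ : 𝓢(ℝ, ℝ)) (hφ : HasCompactSupport φ) :
    ∫ ω, Complex.exp (Complex.I * (((X ω + Y ω) φ : ℝ) : ℂ)) ∂P
      = Complex.exp (∫ t : ℝ, (f (φ t) + g (φ t))) := by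
  have hmX := measurable_pairing hX φ
  have hmY := measurable_pairing hY φ
  have hind : IndepFun (fun ω => X ω φ) (fun ω => Y ω φ) P :=
    hXY.comp (measurable_eval_distribution φ) (measurable_eval_distribution φ)
  have h := congrFun (hind.charFun_map_fun_add_eq_mul hmX.aemeasurable hmY.aemeasurable) 1
  have hcf : ∀ U : Ω → ℝ, Measurable U →
      charFun (P.map U) 1 = ∫ ω, Complex.exp (Complex.I * (U ω : ℂ)) ∂P := by
    intro U hU
    rw [charFun_apply_real, integral_map hU.aemeasurable (by fun_prop)]
    refine integral_congr_ae (ae_of_all _ fun ω => ?_)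
    simp only [Complex.ofReal_one, one_mul]
    rw [mul_comm]
  rw [Pi.mul_apply, hcf (fun ω => X ω φ + Y ω φ) (hmX.add hmY), hcf _ hmX, hcf _ hmY, hfX φ, hgY φ, ← Complex.exp_add,
    ← integral_add] at h
  · exact h
  · exact (hf.comp φ.continuous).integrable_of_hasCompactSupport (hφ.comp_left hf0)
  · exact (hg.comp φ.continuous).integrable_of_hasCompactSupport (hφ.comp_left hg0)

/-! ### Scaling of the increments -/

theorem charFun_map_affine {Ω : Type*} [MeasurableSpace Ω] {P : Measure Ω} {R : Ω → ℝ}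
    (hR : Measurable R) (c d t : ℝ) :
    charFun (P.map fun ω => c * R ω - d) t
      = charFun (P.map R) (c * t) * Complex.exp (-(Complex.I * ((d * t : ℝ) : ℂ))) := by
  rw [charFun_apply_real, charFun_apply_real, integral_map (by fun_prop) (by fun_prop),
    integral_map (by fun_prop) (by fun_prop), ← integral_mul_const]
  refine integral_congr_ae (ae_of_all _ fun ω => ?_)
  simp only [← Complex.exp_add]
  congr 1
  push_cast
  ring

/-- The shift d is chosen to cancel the drift created by scaling the stable exponent. -/
theorem exists_charFun_scaled_eq {Ω : Type*} [MeasurableSpace Ω] {P : Measure Ω} {α : ℝ}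
    (hα : 0 < α) (β σ μ r : ℝ) (ν : Measure ℝ) {n : ℕ} (hn : 1 ≤ n) :
    ∃ d : ℝ, ∀ R : Ω → ℝ, Measurable R →
      (∀ u, charFun (P.map R) u
        = Complex.exp ((stableExponent α β σ μ u + poissonExponent r ν u) / n)) →
      ∀ t, charFun (P.map fun ω => (n : ℝ) ^ (1 / α) * R ω - d) t
        = Complex.exp (stableExponent α β σ μ t
          + poissonExponent r ν ((n : ℝ) ^ (1 / α) * t) / n) := by
  obtain ⟨d, hd⟩ := exists_stableExponent_scaling hα β σ μ hn
  refine ⟨d, fun R hR h t => ?_⟩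
  rw [charFun_map_affine hR, h, ← Complex.exp_add, add_div, hd]
  congr 1
  ring

section Bounds

variable {α σ r : ℝ} {ν : Measure ℝ} [IsProbabilityMeasure ν]

theorem re_poissonExponent_div_nonpos (hr : 0 ≤ r) (n : ℕ) (w : ℝ) :
    (poissonExponent r ν w / n).re ≤ 0 := by
  rw [Complex.div_natCast_re]
  exact div_nonpos_of_nonpos_of_nonneg (poissonExponent_re_nonpos hr w) (Nat.cast_nonneg n)

theorem norm_exp_stableExponent (β μ t : ℝ) :
    ‖Complex.exp (stableExponent α β σ μ t)‖ = Real.exp (-σ ^ α * |t| ^ α) := by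
  rw [Complex.norm_exp, stableExponent_re, neg_mul]

/-- The Poisson exponent has nonpositive real part, so it can only shrink the modulus; the stable
part alone is an envelope for every n. -/
theorem norm_exp_scaled_le (hr : 0 ≤ r) (β μ : ℝ) (n : ℕ) (t w : ℝ) :
    ‖Complex.exp (stableExponent α β σ μ t + poissonExponent r ν w / n)‖
      ≤ Real.exp (-σ ^ α * |t| ^ α) := by
  rw [Complex.exp_add, norm_mul, norm_exp_stableExponent]
  refine mul_le_of_le_one_right (Real.exp_pos _).le ?_
  rw [Complex.norm_exp]
  exact Real.exp_le_one_iff.2 (re_poissonExponent_div_nonpos hr n w)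

/-- The Poisson exponent is bounded by 2r whatever its argument, so dividing by n beats the growing
factor n^(1/α) inside it. -/
theorem norm_exp_scaled_sub_le (hr : 0 ≤ r) (β μ : ℝ) (n : ℕ) (t w : ℝ) :
    ‖Complex.exp (stableExponent α β σ μ t + poissonExponent r ν w / n)
        - Complex.exp (stableExponent α β σ μ t)‖
      ≤ 4 * r / n * Real.exp (-σ ^ α * |t| ^ α) := by
  rw [Complex.exp_add, ← mul_sub_one, norm_mul, norm_exp_stableExponent, mul_comm]
  gcongr
  refine (norm_exp_sub_one_le_of_re_nonpos (re_poissonExponent_div_nonpos hr n w)).trans ?_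
  rw [norm_div, Complex.norm_natCast]
  calc 2 * (‖poissonExponent r ν w‖ / n) ≤ 2 * ((2 * r) / n) := by
        gcongr
        exact norm_poissonExponent_le hr w
    _ = _ := by ring

/-- The constant is free of n: since s ≤ α, the factor (n^(1/α))^s is at most n and is absorbed by
the division by n. -/
theorem norm_one_sub_exp_scaled_le (hα : 0 < α) (hσ : 0 < σ) (hr : 0 ≤ r) {β μ s CX CY : ℝ}
    (hsα : s ≤ α) (hCY : 0 ≤ CY)
    (hX : ∀ w, |w| ≤ 1 → ‖stableExponent α β σ μ w‖ ≤ CX * |w| ^ s)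
    (hY : ∀ w, ‖poissonExponent r ν w‖ ≤ CY * |w| ^ s) {n : ℕ} (hn : 1 ≤ n) {t : ℝ}
    (ht : |t| ≤ 1) :
    ‖1 - Complex.exp (stableExponent α β σ μ t
        + poissonExponent r ν ((n : ℝ) ^ (1 / α) * t) / n)‖ ≤ 2 * (CX + CY) * |t| ^ s := by
  have hn1 : (1 : ℝ) ≤ n := by exact_mod_cast hn
  have hn0 : (0 : ℝ) < n := by linarith
  have hre : (stableExponent α β σ μ t
      + poissonExponent r ν ((n : ℝ) ^ (1 / α) * t) / n).re ≤ 0 := by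
    rw [Complex.add_re, stableExponent_re]
    have h1 := re_poissonExponent_div_nonpos (ν := ν) hr n ((n : ℝ) ^ (1 / α) * t)
    have h2 : 0 ≤ σ ^ α * |t| ^ α := by positivity
    linarith
  rw [norm_sub_rev]
  refine (norm_exp_sub_one_le_of_re_nonpos hre).trans ?_
  rw [mul_assoc]
  gcongr
  refine (norm_add_le _ _).trans ?_
  rw [add_mul]
  gcongr
  · exact hX t ht
  · rw [norm_div, Complex.norm_natCast, div_le_iff₀ hn0]
    refine (hY _).trans ?_
    have hpow : ((n : ℝ) ^ (1 / α)) ^ s ≤ n := by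
      rw [← Real.rpow_mul hn0.le]
      conv_rhs => rw [← Real.rpow_one (n : ℝ)]
      refine Real.rpow_le_rpow_of_exponent_le hn1 ?_
      rw [one_div_mul_eq_div, div_le_one hα]
      exact hsα
    rw [abs_mul, abs_of_nonneg (by positivity : (0 : ℝ) ≤ (n : ℝ) ^ (1 / α)),
      Real.mul_rpow (by positivity) (abs_nonneg t)]
    calc CY * (((n : ℝ) ^ (1 / α)) ^ s * |t| ^ s) ≤ CY * (n * |t| ^ s) := by gcongr
      _ = CY * |t| ^ s * n := by ring

end Bounds

/-! ### The limit theorem -/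

theorem mainTheorem6 {Ω : Type*} [MeasurableSpace Ω] (P : Measure Ω) [IsProbabilityMeasure P]
    (X Y : Ω → RealTemperedDistribution) (α β σ μ r θ : ℝ) (ν : Measure ℝ)
    (hX : IsStableWhiteNoise P X α β σ μ)
    (hY : IsImpulsivePoissonWhiteNoise P Y r ν)
    (hXY : IndepFun X Y P)
    (hθ : 0 < θ) (hν : Integrable (fun a : ℝ => |a| ^ θ) ν) :
    -- the random variables `X₀ = ⟨X, φ⟩` and `Zᵢ⁽ⁿ⁾ = ⟨X + Y, φ_{i,n}⟩` exist
    (∃ X₀ : Ω → ℝ, IsPairing P X pulse X₀) ∧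
    (∀ n : ℕ, 1 ≤ n → ∃ R : ℤ → Ω → ℝ, IsTimeQuantization P (fun ω => X ω + Y ω) n R) ∧
    ∀ (X₀ : Ω → ℝ) (Z : ℕ → ℤ → Ω → ℝ), IsPairing P X pulse X₀ →
      (∀ n : ℕ, 1 ≤ n → IsTimeQuantization P (fun ω => X ω + Y ω) n (Z n)) →
      HasDifferentialEntropy P X₀ ∧
      -- the quantization entropies exist, are finite, and are `n H([Z₁⁽ⁿ⁾]_m)`
      (∀ (n : ℕ) (m : ℝ), 1 ≤ n → 0 < m →
        Tendsto (windowEntropyRate P m n (Z n)) atTop (𝓝 (quantizationEntropy P m n (Z n))) ∧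
        quantizationEntropy P m n (Z n)
          = n * discreteEntropy P (fun ω => quantize m (Z n 1 ω)) ∧
        quantizationEntropy P m n (Z n) ≠ ∞) ∧
      ∀ M : ℕ → ℕ, Tendsto (fun n : ℕ => (M n : ℝ) / (n : ℝ) ^ (1 / α)) atTop atTop →
        Tendsto (fun n : ℕ => ⨆ (m : ℝ) (_ : (M n : ℝ) ≤ m),
            ENNReal.ofReal |(quantizationEntropy P m n (Z n)).toReal / n
              - Real.log (m / (n : ℝ) ^ (1 / α)) - differentialEntropy P X₀|)
          atTop (𝓝 0) := by
  have hα := hX.alpha_pos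
  have hσ := hX.sigma_pos
  have hr := hY.rate_pos.le
  have hνp := hY.amplitude
  have hfX := continuous_stableExponent hα β σ μ
  have hfX0 := stableExponent_zero hα β σ μ
  have hfY := continuous_poissonExponent r ν
  have hfY0 := poissonExponent_zero r ν
  have hEX : ∀ φ : 𝓢(ℝ, ℝ), HasCompactSupport φ →
      ∫ ω, Complex.exp (Complex.I * ((X ω φ : ℝ) : ℂ)) ∂P
        = Complex.exp (∫ t : ℝ, stableExponent α β σ μ (φ t)) := fun φ _ => hX.exponent φ
  have hEZ := exponent_add_of_indepFun hX.measurable hY.measurable hXY hfX hfX0 hfY hfY0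
    hX.exponent hY.exponent
  have hZm := measurable_add_distribution hX.measurable hY.measurable
  have hfZ : Continuous fun w => stableExponent α β σ μ w + poissonExponent r ν w := hfX.add hfY
  have hfZ0 : stableExponent α β σ μ 0 + poissonExponent r ν 0 = 0 := by rw [hfX0, hfY0, add_zero]
  -- `X₀` is the sample with index 1 for n = 1, so the results on samples cover it.
  have hpulse : (fun t : ℝ => pulse ((1 : ℕ) * t - (1 : ℤ) + 1)) = pulse := by
    funext t
    simp
  refine ⟨?_, fun n hn => ?_, fun X₀ Z hX₀ hZ => ?_⟩
  · obtain ⟨R, hR⟩ := exists_isPairing_pulse hX.measurable hfX hfX0 hEX le_rfl 1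
    rw [hpulse] at hR
    exact ⟨R, hR⟩
  · choose R hR using fun i => exists_isPairing_pulse hZm hfZ hfZ0 hEZ hn i
    exact ⟨R, hR⟩
  -- The exponent must satisfy 1/2 for the logarithm at α = 1, α for uniformity in n, and θ for the
  -- amplitude moment.
  obtain ⟨s, hs, hs12, hsα, hsθ⟩ : ∃ s : ℝ, 0 < s ∧ s ≤ 1 / 2 ∧ s ≤ α ∧ s ≤ θ :=
    ⟨min (1 / 2) (min α θ), by positivity, min_le_left _ _,
      (min_le_right _ _).trans (min_le_left _ _), (min_le_right _ _).trans (min_le_right _ _)⟩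
  obtain ⟨CX, hCX, hbX⟩ := exists_norm_stableExponent_le hs12 hs hsα β σ μ
  obtain ⟨CY, hCY, hbY⟩ := exists_norm_poissonExponent_le_rpow hr hs (by linarith) hsθ hν
  obtain ⟨K, hK, hmom⟩ := exists_lintegral_rpow_le_of_charFun
    (show 0 ≤ 2 * (CX + CY) by positivity) hs (by linarith)
  have hG : Integrable fun t : ℝ => Real.exp (-σ ^ α * |t| ^ α) :=
    integrable_exp_neg_mul_abs_rpow hα (Real.rpow_pos_of_pos hσ α)
  -- the law of `X₀`
  have hφ₀ : ∀ t, charFun (P.map X₀) t = Complex.exp (stableExponent α β σ μ t) := by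
    intro t
    have h := charFun_isPairing hX.measurable hfX hfX0 hEX le_rfl (i := 1) (R := X₀)
      (by rw [hpulse]; exact hX₀) t
    simpa using h
  have hp₀ : IsProbabilityMeasure (P.map X₀) :=
    Measure.isProbabilityMeasure_map hX₀.1.aemeasurable
  have hb₀ : ∀ t, ‖charFun (P.map X₀) t‖ ≤ Real.exp (-σ ^ α * |t| ^ α) := fun t => by
    rw [hφ₀, norm_exp_stableExponent]
  have hw₀ : ∫⁻ x, ENNReal.ofReal (|x| ^ (s / 2)) ∂(P.map X₀) ≤ K := by
    refine hmom _ hp₀ fun t ht => ?_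
    rw [hφ₀, norm_sub_rev]
    have hre : (stableExponent α β σ μ t).re ≤ 0 := by
      rw [stableExponent_re]
      have : 0 ≤ σ ^ α * |t| ^ α := by positivity
      linarith
    refine (norm_exp_sub_one_le_of_re_nonpos hre).trans ?_
    have h1 : 0 ≤ CY * |t| ^ s := by positivity
    have h2 := hbX t ht
    linarith
  obtain ⟨hent, hdiff⟩ := hasDifferentialEntropy_of_charFun P hX₀.1 (half_pos hs)
    (integrable_charFun_of_le hG hb₀) (ne_top_of_le_ne_top hK hw₀)
  -- the laws of the normalized increments
  choose! d hd using fun (n : ℕ) (hn : 1 ≤ n) =>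
    exists_charFun_scaled_eq (P := P) hα β σ μ r ν hn
  set W : ℕ → Ω → ℝ := fun n ω => (n : ℝ) ^ (1 / α) * Z n 1 ω - d n with hWdef
  have hZ1 : ∀ n, 1 ≤ n → Measurable (Z n 1) := fun n hn => (hZ n hn 1).1
  have hφ : ∀ n, 1 ≤ n → ∀ t, charFun (P.map (W n)) t = Complex.exp (stableExponent α β σ μ t
      + poissonExponent r ν ((n : ℝ) ^ (1 / α) * t) / n) := fun n hn =>
    hd n hn (Z n 1) (hZ1 n hn) fun u => charFun_isPairing hZm hfZ hfZ0 hEZ hn (hZ n hn 1) u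
  have hpW : ∀ n, 1 ≤ n → IsProbabilityMeasure (P.map (W n)) := fun n hn =>
    Measure.isProbabilityMeasure_map (((hZ1 n hn).const_mul _).sub_const _).aemeasurable
  have hwW : ∀ n, 1 ≤ n → ∫⁻ x, ENNReal.ofReal (|x| ^ (s / 2)) ∂(P.map (W n)) ≤ K := by
    intro n hn
    refine hmom _ (hpW n hn) fun t ht => ?_
    rw [hφ n hn]
    exact norm_one_sub_exp_scaled_le hα hσ hr hsα hCY hbX hbY hn ht
  have hH : ∀ (n : ℕ) (m : ℝ), 1 ≤ n → 0 < m →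
      discreteEntropy P (fun ω => quantize m (Z n 1 ω)) ≠ ∞ ∧
      (discreteEntropy P (fun ω => quantize m (Z n 1 ω))).toReal
        = (∫ x, Real.negMulLog (binDensity (P.map (W n)) (1 / 2 + m / (n : ℝ) ^ (1 / α) * d n)
          (m / (n : ℝ) ^ (1 / α)) x)) + Real.log (m / (n : ℝ) ^ (1 / α)) := by
    intro n m hn hm
    have hn0 : (0 : ℝ) < n := by exact_mod_cast hn
    exact discreteEntropy_quantize_affine P (hZ1 n hn) (Real.rpow_pos_of_pos hn0 _) hm
      (half_pos hs) (by linarith) (ne_top_of_le_ne_top hK (hwW n hn))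
  have hrate : ∀ (n : ℕ) (m : ℝ), 1 ≤ n → 0 < m →
      Tendsto (windowEntropyRate P m n (Z n)) atTop
        (𝓝 (n * discreteEntropy P (fun ω => quantize m (Z n 1 ω)))) := fun n m hn hm =>
    tendsto_windowEntropyRate P (fun i => (hZ n hn i).1)
      (iIndepFun_isTimeQuantization hZm hfZ hfZ0 hEZ hn (hZ n hn))
      (fun i => map_isTimeQuantization_eq hZm hfZ hfZ0 hEZ hn (hZ n hn) i 1) hm n
  have hQ : ∀ (n : ℕ) (m : ℝ), 1 ≤ n → 0 < m → quantizationEntropy P m n (Z n)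
      = n * discreteEntropy P (fun ω => quantize m (Z n 1 ω)) := fun n m hn hm =>
    (hrate n m hn hm).limUnder_eq
  refine ⟨hent, fun n m hn hm => ⟨?_, hQ n m hn hm, ?_⟩, fun M hM => ?_⟩
  · rw [hQ n m hn hm]
    exact hrate n m hn hm
  · rw [hQ n m hn hm]
    exact ENNReal.mul_ne_top (ENNReal.natCast_ne_top n) (hH n m hn hm).1
  -- Along this filter n tends to infinity and m is any real number at least `M n`, so one limit
  -- along `l` is uniform in such m.
  set l : Filter (ℕ × ℝ) := comap Prod.fst atTop ⊓ 𝓟 {q : ℕ × ℝ | (M q.1 : ℝ) ≤ q.2} with hl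
  have hlM : ∀ᶠ q in l, (M q.1 : ℝ) ≤ q.2 := mem_inf_of_right (mem_principal_self _)
  have hl1 : Tendsto Prod.fst l atTop := tendsto_comap.mono_left inf_le_left
  have hln : ∀ᶠ q in l, 1 ≤ q.1 := hl1.eventually_ge_atTop 1
  have hlm : Tendsto (fun q : ℕ × ℝ => q.2 / (q.1 : ℝ) ^ (1 / α)) l atTop := by
    refine tendsto_atTop_mono' l ?_ (hM.comp hl1)
    filter_upwards [hlM] with q hq
    exact div_le_div_of_nonneg_right hq (by positivity)
  have hL1 : Tendsto (fun q : ℕ × ℝ => ∫ t, ‖charFun (P.map (W q.1)) t - charFun (P.map X₀) t‖)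
      l (𝓝 0) := by
    have h1 : Tendsto (fun q : ℕ × ℝ =>
        4 * r / (q.1 : ℝ) * ∫ t : ℝ, Real.exp (-σ ^ α * |t| ^ α)) l (𝓝 0) := by
      have h2 := (tendsto_const_div_atTop_nhds_zero_nat (4 * r)).comp hl1
      simpa using h2.mul_const (∫ t : ℝ, Real.exp (-σ ^ α * |t| ^ α))
    refine tendsto_of_tendsto_of_tendsto_of_le_of_le' tendsto_const_nhds h1
      (Eventually.of_forall fun q => integral_nonneg fun t => norm_nonneg _) ?_
    filter_upwards [hln] with q hq
    rw [← integral_const_mul]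
    refine integral_mono_of_nonneg (ae_of_all _ fun t => norm_nonneg _) (hG.const_mul _)
      (ae_of_all _ fun t => ?_)
    simp only
    rw [hφ q.1 hq, hφ₀]
    exact norm_exp_scaled_sub_le hr β μ q.1 t _
  have hmain := tendsto_integral_negMulLog_binDensity (l := l) (μ := fun q => P.map (W q.1))
    (μ₀ := P.map X₀) (u := fun q => 1 / 2 + q.2 / (q.1 : ℝ) ^ (1 / α) * d q.1)
    (m := fun q => q.2 / (q.1 : ℝ) ^ (1 / α)) hG (half_pos hs) (by linarith) hK
    (by filter_upwards [hln] with q hq using hpW q.1 hq)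
    (by
      filter_upwards [hln] with q hq t
      rw [hφ q.1 hq]
      exact norm_exp_scaled_le hr β μ q.1 t _)
    hb₀ hL1 (by filter_upwards [hln] with q hq using hwW q.1 hq) hw₀ hlm
  have hzero : Tendsto (fun q : ℕ × ℝ => ENNReal.ofReal
      |(quantizationEntropy P q.2 q.1 (Z q.1)).toReal / q.1
        - Real.log (q.2 / (q.1 : ℝ) ^ (1 / α)) - differentialEntropy P X₀|) l (𝓝 0) := by
    have h1 := (ENNReal.continuous_ofReal.tendsto _).comp
      (hmain.sub_const (differentialEntropy P X₀)).abs
    rw [hdiff, sub_self, abs_zero, ENNReal.ofReal_zero, ← hdiff] at h1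
    refine h1.congr' ?_
    filter_upwards [hln, hlm.eventually_gt_atTop 0] with q hq hq2
    have hn0 : (0 : ℝ) < q.1 := by exact_mod_cast hq
    have hm0 : 0 < q.2 := by
      have := mul_pos hq2 (Real.rpow_pos_of_pos hn0 (1 / α))
      rwa [div_mul_cancel₀ _ (Real.rpow_pos_of_pos hn0 (1 / α)).ne'] at this
    simp only [Function.comp_apply]
    rw [hQ q.1 q.2 hq hm0, ENNReal.toReal_mul, ENNReal.toReal_natCast,
      mul_div_cancel_left₀ _ hn0.ne', (hH q.1 q.2 hq hm0).2, add_sub_cancel_right]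
  rw [ENNReal.tendsto_nhds_zero] at hzero ⊢
  intro ε hε
  have h1 := hzero ε hε
  -- Unfolding the filter yields the bound for all large n and every m ≥ `M n` at once, which bounds
  -- the supremum.
  rw [hl, eventually_inf_principal, eventually_comap] at h1
  filter_upwards [h1] with n hn
  exact iSup₂_le fun m hm => hn (n, m) rfl hm
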